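/- Let $p>2$ and $0<\theta<1/2$. Let $T$ be a tree on the vertex set $\{1,\dots,p\}$ with edge set $\mathcal E_P$, and let $P$ be a probability distribution on $\{0,1\}^p$ that is a graphical model on $T$, i.e. $P(\mathbf x)=\prod_i P_i(x_i)\prod_{\{i,j\}\in\mathcal E_P}\frac{P_{i,j}(x_i,x_j)}{P_i(x_i)P_j(x_j)}$ with $P_i$, $P_{i,j}$ the marginals of $P$, such that $P_i(0)=P_i(1)=\tfrac12$ for every node $i$ and $P_{i,j}(0,1)=P_{i,j}(1,0)=\theta/2$ for every edge $\{i,j\}\in\mathcal E_P$. Let $\mathcal D(\mathcal T^p,\theta)$ be the set of all distributions of this kind, over all trees on $\{1,\dots,p\}$. For $0\le q<1/2$ let $$P^{(q)}(\mathbf y)=\sum_{\mathbf x\in\{0,1\}^p}q^{\delta_{\mathbf x,\mathbf y}}(1-q)^{p-\delta_{\mathbf x,\mathbf y}}P(\mathbf x)$$ be the law of the output when each component of $\mathbf x\sim P$ is passed through a memoryless binary symmetric channel with crossover probability $q$, where $\delta_{\mathbf x,\mathbf y}$ is the Hamming distance. Let $\mathbf y_1,\mathbf y_2,\dots$ be i.i.d.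 with law $P^{(q)}$, let $\widehat P^{(q)}$ be the empirical distribution of $\mathbf y^n=(\mathbf y_1,\dots,\mathbf y_n)$, with pair marginals $\widehat P^{(q)}_{i,j}$, and put $\widehat A^{(q)}_{i,j}=\widehat P^{(q)}_{i,j}(0,0)+\widehat P^{(q)}_{i,j}(1,1)$. Let $\widehat{\mathcal E}^{(q)}(\mathbf y^n)$ be the edge set of a maximum weight spanning tree of the complete graph on $\{1,\dots,p\}$ in which the edge $\{i,j\}$ has weight $\widehat A^{(q)}_{i,j}$, ties being broken in an arbitrary (possibly random) way. Then the limit $$K_P^{(q)}:=\lim_{n\to\infty}-\frac1n\log\mathbb P\big(\widehat{\mathcal E}^{(q)}(\mathbf y^n)\neq\mathcal E_P\big)$$ exists and $$K_P^{(q)}=-\log\left(1-4\Big(\frac{\beta_1+\beta_2}{2}-\sqrt{\beta_1\beta_2}\Big)\right),$$ where $$\beta_1=\big((1-q)^3+q^3\big)\frac{\theta(1-\theta)}2+q(1-q)\,\frac{1-\theta(1-\theta)}2,\qquad \beta_2=\big((1-q)^3+q^3\big)\frac{\theta^2}2+q(1-q)\,\frac{1-\theta^2}2 .$$ Moreover,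 the value at $q=0$ is the exponent $K_P$ of maximum likelihood learning from noiseless samples: if $\mathbf x_1,\mathbf x_2,\dots$ are i.i.d. with law $P$ and $\mathcal E_{\mathrm{ML}}(\mathbf x^n)$ is the edge set of a maximizer of $\sum_{k=1}^n\log Q(\mathbf x_k)$ over $Q\in\mathcal D(\mathcal T^p,\theta)$ (ties broken arbitrarily), then $$K_P:=\lim_{n\to\infty}-\frac1n\log\mathbb P\big(\mathcal E_{\mathrm{ML}}(\mathbf x^n)\ne\mathcal E_P\big)=K_P^{(0)}=-\log\Big(1-\theta\big(1-\sqrt{4\theta(1-\theta)}\big)\Big).$$ -/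

import Mathlib

open MeasureTheory ProbabilityTheory Filter Topology

noncomputable section

/-- The marginal `Q_i(a)` at node `i` of a function `Q` on `{0,1}^p`. -/
def nodeMarginal {p : ℕ} (Q : (Fin p → Fin 2) → ℝ) (i : Fin p) (a : Fin 2) : ℝ :=
  ∑ x : Fin p → Fin 2 with x i = a, Q x

/-- The marginal `Q_{i,j}(a,b)` on the pair of nodes `(i,j)` of a function `Q` on `{0,1}^p`. -/
def pairMarginal {p : ℕ} (Q : (Fin p → Fin 2) → ℝ) (i j : Fin p) (a b : Fin 2) : ℝ :=
  ∑ x : Fin p → Fin 2 with x i = a ∧ x j = b, Q x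

theorem pairMarginal_comm {p : ℕ} (Q : (Fin p → Fin 2) → ℝ) (i j : Fin p) (a b : Fin 2) :
    pairMarginal Q i j a b = pairMarginal Q j i b a := by
  simp only [pairMarginal, and_comm]

/-- The edge factor `Q_{i,j}(x_i,x_j) / (Q_i(x_i) Q_j(x_j))` of the unordered pair `{i,j}`. -/
def edgeFactor {p : ℕ} (Q : (Fin p → Fin 2) → ℝ) (x : Fin p → Fin 2) : Sym2 (Fin p) → ℝ :=
  Sym2.lift ⟨fun i j =>
    pairMarginal Q i j (x i) (x j) / (nodeMarginal Q i (x i) * nodeMarginal Q j (x j)),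
    fun i j => by
      dsimp only
      rw [pairMarginal_comm, mul_comm (nodeMarginal Q i (x i))]⟩

open Classical in
/-- `P` is a probability mass function on `{0,1}^p` that is a graphical model on the tree `T`,
has uniform node marginals, and satisfies `P_{i,j}(0,1) = P_{i,j}(1,0) = θ/2` on every edge
of `T`. -/
structure IsTreeModel {p : ℕ} (θ : ℝ) (T : SimpleGraph (Fin p))
    (P : (Fin p → Fin 2) → ℝ) : Prop where
  isTree : T.IsTree
  mem_stdSimplex : P ∈ stdSimplex ℝ (Fin p → Fin 2)
  factorizes : ∀ x, P x = (∏ i, nodeMarginal P i (x i)) * ∏ e ∈ T.edgeFinset, edgeFactor P x e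
  uniform : ∀ i a, nodeMarginal P i a = 1 / 2
  homogeneous : ∀ i j, T.Adj i j → pairMarginal P i j 0 1 = θ / 2 ∧ pairMarginal P i j 1 0 = θ / 2

/-- The law of the output when each coordinate of a vector of law `P` is passed
through a memoryless binary symmetric channel with crossover probability `q`. -/
def bscOutput {p : ℕ} (q : ℝ) (P : (Fin p → Fin 2) → ℝ) (y : Fin p → Fin 2) : ℝ :=
  ∑ x : Fin p → Fin 2, q ^ hammingDist x y * (1 - q) ^ (p - hammingDist x y) * P x

/-- The empirical distribution of `n` samples. -/
def empiricalDist {p n : ℕ} (y : Fin n → Fin p → Fin 2) (z : Fin p → Fin 2) : ℝ :=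
  1 / (n : ℝ) * ∑ k : Fin n, if y k = z then 1 else 0

/-- The weight `Â_{i,j} = P̂_{i,j}(0,0) + P̂_{i,j}(1,1)` of the unordered pair `{i,j}`, where `P̂`
is the empirical distribution of the samples. -/
def agreementWeight {p n : ℕ} (y : Fin n → Fin p → Fin 2) : Sym2 (Fin p) → ℝ :=
  Sym2.lift ⟨fun i j =>
    pairMarginal (empiricalDist y) i j 0 0 + pairMarginal (empiricalDist y) i j 1 1,
    fun i j => by
      dsimp only
      rw [pairMarginal_comm _ i j 0 0, pairMarginal_comm _ i j 1 1]⟩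

open Classical in
/-- The total weight of the edges of a graph. -/
def graphWeight {p : ℕ} (w : Sym2 (Fin p) → ℝ) (G : SimpleGraph (Fin p)) : ℝ :=
  ∑ e ∈ G.edgeFinset, w e

/-- `G` is a maximum weight spanning tree of the complete graph on `p` nodes with edge
weights `w`. -/
def IsMWST {p : ℕ} (w : Sym2 (Fin p) → ℝ) (G : SimpleGraph (Fin p)) : Prop :=
  G.IsTree ∧ ∀ G' : SimpleGraph (Fin p), G'.IsTree → graphWeight w G' ≤ graphWeight w G

/-- `G` is the tree of a maximum likelihood estimate, given the samples `x`, in the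
class of all tree models with parameter `θ`. -/
def IsMLTree {p n : ℕ} (θ : ℝ) (x : Fin n → Fin p → Fin 2) (G : SimpleGraph (Fin p)) : Prop :=
  ∃ Q, IsTreeModel θ G Q ∧ ∀ G' Q', IsTreeModel θ G' Q' →
    ∑ k, Real.log (Q' (x k)) ≤ ∑ k, Real.log (Q (x k))

/-- `Y 0, Y 1, …` are independent samples, each of law `D`. -/
structure IsIIDSample {Ω : Type*} [MeasurableSpace Ω] (μ : Measure Ω) {p : ℕ}
    (D : (Fin p → Fin 2) → ℝ) (Y : ℕ → Ω → Fin p → Fin 2) : Prop where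
  measurable : ∀ k, Measurable (Y k)
  indep : iIndepFun Y μ
  law : ∀ k y, μ.real {ω | Y k ω = y} = D y

/-- The error probability `μ(Ê n ≠ T)` of the tree estimates `Ê n` of `T` has exponent `K`. -/
def HasErrorExponent {Ω : Type*} [MeasurableSpace Ω] (μ : Measure Ω) {p : ℕ}
    (T : SimpleGraph (Fin p)) (E : ℕ → Ω → SimpleGraph (Fin p)) (K : ℝ) : Prop :=
  Tendsto (fun n : ℕ => -(1 / (n : ℝ)) * Real.log (μ.real {ω | E n ω ≠ T})) atTop (𝓝 K)

def beta₁ (q θ : ℝ) : ℝ :=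
  ((1 - q) ^ 3 + q ^ 3) * (θ * (1 - θ) / 2) + q * (1 - q) * ((1 - θ * (1 - θ)) / 2)

def beta₂ (q θ : ℝ) : ℝ :=
  ((1 - q) ^ 3 + q ^ 3) * (θ ^ 2 / 2) + q * (1 - q) * ((1 - θ ^ 2) / 2)

/-- The explicit value of the error exponent with crossover probability `q`. -/
def noisyExponent (q θ : ℝ) : ℝ :=
  -Real.log (1 - 4 * ((beta₁ q θ + beta₂ q θ) / 2 - √(beta₁ q θ * beta₂ q θ)))

end

/-!
A maximum weight spanning tree differs from `T` only if for some *crossing* `(e, f)` of `T`, i.e. an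
edge `e` and a pair `f` whose ends are joined in `T` by a path through `e`, the pair `f` has at
least the weight of `e`; conversely, if `f` is strictly heavier than `e`, it does differ from `T`.
So the exponent is that of the most likely crossing error.

For a fixed crossing, `n` times the difference of the weights is a random walk with steps in
`{-1, 0, 1}`. Its step law is read off from the moments of the edge spins (`1` for agreement, `-1`
for disagreement), which are powers of `ρ = 1 - 2θ`: flipping all bits on one side of an edge of a
forest shows that the spins of distinct edges are independent under the uniform law. The channel
multiplies each moment by a power of `1 - 2q`. Two adjacent edges of `T` form a crossing whose steps
go up with probability `2β₂` and down with probability `2β₁`, and Chernoff's bound at the parameter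
`√(β₁/β₂)` which is optimal for them gives at most `exp (-nK)` for *every* crossing.

For the matching lower bound, rescaling the variable by the same parameter makes the step polynomial
palindromic, and then Cauchy–Schwarz bounds the middle coefficient of its `n`-th power from below by
its value at `1` over `n + 1`. The polynomial factor does not affect the exponent.

Finally, the log-likelihood of a tree is an increasing affine function of its agreement weight, so
maximum likelihood trees are maximum weight spanning trees.
-/

open SimpleGraph Finset Polynomial

section Trees

variable {V : Type*} {G T : SimpleGraph V} {i k : V} {e f : Sym2 V}

theorem mem_edges_iff_not_reachable_deleteEdges (hG : G.IsAcyclic) {p : G.Walk i k}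
    (hp : p.IsPath) : e ∈ p.edges ↔ ¬(G.deleteEdges {e}).Reachable i k := by
  classical
  induction e with | h u v
  refine ⟨fun he hr ↦ ?_, p.mem_edges_of_not_reachable_deleteEdges⟩
  obtain ⟨q, hq⟩ := reachable_deleteEdges_iff_exists_walk.1 hr
  have hpq : p = q.bypass :=
    congrArg Subtype.val ((hG.subsingleton_path i k).elim ⟨p, hp⟩ ⟨q.bypass, q.bypass_isPath⟩)
  exact hq (q.edges_bypass_subset_edges (hpq ▸ he))

theorem notMem_edgeSet_deleteEdges_of_mem_edges (hT : T.IsAcyclic) {p : T.Walk i k}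
    (hp : p.IsPath) (he : e ∈ p.edges) : s(i, k) ∉ (T.deleteEdges {e}).edgeSet :=
  fun h ↦ (mem_edges_iff_not_reachable_deleteEdges hT hp).1 he (Adj.reachable h)

theorem ne_of_isPath_of_mem_edges {p : T.Walk i k} (hp : p.IsPath) (he : e ∈ p.edges) :
    i ≠ k := by
  rintro rfl
  simp [Walk.eq_nil_iff_nil.2 (Walk.isPath_iff_nil.1 hp)] at he

theorem edgeFinset_exchange [DecidableEq V] [Fintype T.edgeSet]
    [Fintype (T.deleteEdges {e} ⊔ edge i k).edgeSet] {p : T.Walk i k} (hp : p.IsPath)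
    (he : e ∈ p.edges) :
    (T.deleteEdges {e} ⊔ edge i k).edgeFinset = insert s(i, k) (T.edgeFinset.erase e) := by
  ext f
  simp only [mem_edgeFinset, edgeSet_sup, edgeSet_deleteEdges,
    edgeSet_edge_of_ne (ne_of_isPath_of_mem_edges hp he), mem_insert, mem_erase, Set.mem_union,
    Set.mem_sdiff, Set.mem_singleton_iff]
  tauto

theorem notMem_erase_edgeFinset_of_mem_edges [DecidableEq V] [Fintype T.edgeSet]
    (hT : T.IsAcyclic) {p : T.Walk i k} (hp : p.IsPath) (he : e ∈ p.edges) :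
    s(i, k) ∉ T.edgeFinset.erase e := by
  have h := notMem_edgeSet_deleteEdges_of_mem_edges hT hp he
  rw [edgeSet_deleteEdges] at h
  simp only [mem_erase, mem_edgeFinset]
  exact fun ⟨hne, hmem⟩ ↦ h ⟨hmem, hne⟩

theorem isTree_exchange [Finite V] (hT : T.IsTree) {p : T.Walk i k} (hp : p.IsPath)
    (he : e ∈ p.edges) : (T.deleteEdges {e} ⊔ edge i k).IsTree := by
  classical
  have := Fintype.ofFinite V
  have := hT.connected.nonempty
  have hacyc : (T.deleteEdges {e} ⊔ edge i k).IsAcyclic :=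
    .sup_edge_of_not_reachable ((mem_edges_iff_not_reachable_deleteEdges hT.isAcyclic hp).1 he)
      (hT.isAcyclic.anti (deleteEdges_le _))
  obtain ⟨F, hle, -, hF⟩ := connected_top.exists_isTree_le_of_le_of_isAcyclic le_top hacyc
  have hcard : #(T.deleteEdges {e} ⊔ edge i k).edgeFinset = #T.edgeFinset := by
    rw [edgeFinset_exchange hp he, card_insert_of_notMem
      (notMem_erase_edgeFinset_of_mem_edges hT.isAcyclic hp he),
      card_erase_add_one (mem_edgeFinset.2 (p.edges_subset_edgeSet he))]
  have hFT : #F.edgeFinset = #T.edgeFinset :=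
    Nat.add_right_cancel (hF.card_edgeFinset.trans hT.card_edgeFinset.symm)
  have hEq : T.deleteEdges {e} ⊔ edge i k = F :=
    edgeFinset_inj.1 (eq_of_subset_of_card_le (edgeFinset_mono hle) (by lia))
  exact hEq ▸ hF

theorem exists_adj_adj_ne [Fintype V] (hG : G.Connected) (hV : 2 < Fintype.card V) :
    ∃ i j k, G.Adj i j ∧ G.Adj j k ∧ i ≠ k := by
  classical
  have := Fintype.one_lt_card_iff_nontrivial.1 (Nat.lt_of_succ_lt hV)
  obtain ⟨a⟩ := hG.nonempty
  obtain ⟨b, hab⟩ := hG.preconnected.exists_adj_of_nontrivial a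
  obtain ⟨c, -, hc⟩ := exists_mem_notMem_of_card_lt_card
    ((card_le_two (a := a) (b := b)).trans_lt (hV.trans_eq card_univ.symm))
  obtain ⟨p⟩ := hG.preconnected a c
  obtain ⟨d, -, hd, hd'⟩ := p.exists_boundary_dart {a, b} (by simp) (by simpa using hc)
  simp only [Set.mem_insert_iff, Set.mem_singleton_iff, not_or] at hd hd'
  rcases hd with h | h
  · exact ⟨b, a, d.snd, hab.symm, h ▸ d.adj, Ne.symm hd'.2⟩
  · exact ⟨a, b, d.snd, hab, h ▸ d.adj, Ne.symm hd'.1⟩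

/-- `f` joins the two components of `T` minus the edge `e` and differs from `e`: the pairs `(e, f)`
such that trading `e` for `f` turns the tree `T` into another tree. It is encoded by the path of `T`
between the ends of `f`, which has to traverse `e`. -/
def IsCrossing (T : SimpleGraph V) (e f : Sym2 V) : Prop :=
  ∃ (i k : V) (p : T.Walk i k), p.IsPath ∧ f = s(i, k) ∧ e ∈ p.edges ∧ f ≠ e

theorem IsCrossing.mem_edgeSet (h : IsCrossing T e f) : e ∈ T.edgeSet := by
  obtain ⟨i, k, p, -, -, he, -⟩ := h
  exact p.edges_subset_edgeSet he

theorem IsCrossing.not_isDiag (h : IsCrossing T e f) : ¬f.IsDiag := by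
  obtain ⟨i, k, p, hp, rfl, he, -⟩ := h
  exact ne_of_isPath_of_mem_edges hp he

end Trees

section SpanningTrees

variable {p : ℕ} {w : Sym2 (Fin p) → ℝ} {T G : SimpleGraph (Fin p)}

theorem graphWeight_exchange (hT : T.IsAcyclic) {i k : Fin p} {e : Sym2 (Fin p)}
    {q : T.Walk i k} (hq : q.IsPath) (he : e ∈ q.edges) :
    graphWeight w (T.deleteEdges {e} ⊔ edge i k) + w e = graphWeight w T + w s(i, k) := by
  classical
  have hnew : graphWeight w (T.deleteEdges {e} ⊔ edge i k) =
      w s(i, k) + ∑ f ∈ T.edgeFinset.erase e, w f := by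
    rw [← sum_insert (f := w) (notMem_erase_edgeFinset_of_mem_edges hT hq he),
      ← edgeFinset_exchange hq he, graphWeight]
    congr!
  rw [hnew, graphWeight, ← sum_erase_add _ _ (mem_edgeFinset.2 (q.edges_subset_edgeSet he))]
  ring

theorem IsMWST.weight_le (h : IsMWST w G) {i k : Fin p} {e : Sym2 (Fin p)} {q : G.Walk i k}
    (hq : q.IsPath) (he : e ∈ q.edges) : w s(i, k) ≤ w e := by
  have hmax := h.2 _ (isTree_exchange h.1 hq he)
  have hexch := graphWeight_exchange (w := w) h.1.isAcyclic hq he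
  linarith

theorem IsMWST.exists_isCrossing (h : IsMWST w G) (hT : T.IsTree) (hne : G ≠ T) :
    ∃ e f, IsCrossing T e f ∧ w e ≤ w f := by
  have hnle : ¬T ≤ G := fun hle ↦
    hne ((isTree_iff_minimal_connected.1 h.1).eq_of_le hT.connected hle).symm
  obtain ⟨u, v, hT_adj, hG_adj⟩ : ∃ u v, T.Adj u v ∧ ¬G.Adj u v := by
    simpa [SimpleGraph.le_iff_adj] using hnle
  obtain ⟨q, hq⟩ := h.1.connected.exists_isPath u v
  -- The path of `G` from `u` to `v` leaves the component of `u` in `T` minus the edge `uv`.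
  obtain ⟨d, hd, hfst, hsnd⟩ := q.exists_boundary_dart
    {x | (T.deleteEdges {s(u, v)}).Reachable u x} (Reachable.refl u)
    (isAcyclic_iff_forall_adj_isBridge.1 hT.isAcyclic hT_adj)
  have hd_mem : d.edge ∈ q.edges := List.mem_map_of_mem hd
  obtain ⟨r, hr⟩ := hT.connected.exists_isPath d.fst d.snd
  refine ⟨s(u, v), d.edge, ⟨d.fst, d.snd, r, hr, rfl, ?_, ?_⟩, h.weight_le hq hd_mem⟩
  · exact (mem_edges_iff_not_reachable_deleteEdges hT.isAcyclic hr).2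
      fun hreach ↦ hsnd (Reachable.trans hfst hreach)
  · exact fun heq ↦ hG_adj ((mem_edgeSet G).1 (heq ▸ d.edge_mem))

end SpanningTrees

section Spins

variable {V : Type*}

/-- The sign `(-1)^a` of a bit `a`. -/
noncomputable def spin (a : Fin 2) : ℝ := if a = 0 then 1 else -1

theorem spin_mul_self (a : Fin 2) : spin a * spin a = 1 := by
  fin_cases a <;> simp [spin]

theorem spin_add_one (a : Fin 2) : spin (a + 1) = -spin a := by
  fin_cases a <;> simp [spin]

theorem ite_eq_spin (a b : Fin 2) : (if a = b then 1 else 0 : ℝ) = (1 + spin b * spin a) / 2 := by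
  fin_cases a <;> fin_cases b <;> norm_num [spin]

/-- The product of the spins at the two ends of an unordered pair, i.e. `1` if the two bits agree
and `-1` if they differ. -/
noncomputable def edgeSpin (x : V → Fin 2) : Sym2 V → ℝ :=
  Sym2.lift ⟨fun i j ↦ spin (x i) * spin (x j), fun _ _ ↦ mul_comm _ _⟩

@[simp] theorem edgeSpin_mk (x : V → Fin 2) (i j : V) :
    edgeSpin x s(i, j) = spin (x i) * spin (x j) := rfl

theorem edgeSpin_mul_self (x : V → Fin 2) (e : Sym2 V) : edgeSpin x e * edgeSpin x e = 1 := by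
  induction e with
  | h i j => rw [edgeSpin_mk, mul_mul_mul_comm, spin_mul_self, spin_mul_self, one_mul]

theorem abs_edgeSpin (x : V → Fin 2) (e : Sym2 V) : |edgeSpin x e| = 1 :=
  (abs_eq zero_le_one).2 (mul_self_eq_one_iff.1 (edgeSpin_mul_self x e))

theorem ite_isDiag_map (x : V → Fin 2) (e : Sym2 V) :
    (if (e.map x).IsDiag then 1 else 0 : ℝ) = (1 + edgeSpin x e) / 2 := by
  induction e with
  | h i j => simp [ite_eq_spin, mul_comm]

theorem prod_edgeSpin_edges {G : SimpleGraph V} {i k : V} (p : G.Walk i k) (x : V → Fin 2) :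
    (p.edges.map (edgeSpin x)).prod = edgeSpin x s(i, k) := by
  induction p with
  | nil => simp [spin_mul_self]
  | @cons i j k _ p ih =>
    rw [Walk.edges_cons, List.map_cons, List.prod_cons, ih, edgeSpin_mk, edgeSpin_mk, edgeSpin_mk]
    linear_combination spin (x i) * spin (x k) * spin_mul_self (x j)

theorem prod_edgeSpin_toFinset_edges [DecidableEq V] {G : SimpleGraph V} {i k : V}
    {p : G.Walk i k} (hp : p.IsPath) (x : V → Fin 2) :
    ∏ e ∈ p.edges.toFinset, edgeSpin x e = edgeSpin x s(i, k) := by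
  rw [List.prod_toFinset _ hp.isTrail.edges_nodup, prod_edgeSpin_edges]

theorem prod_edgeSpin_erase_edges [DecidableEq V] {G : SimpleGraph V} {i k : V} {e : Sym2 V}
    {p : G.Walk i k} (hp : p.IsPath) (he : e ∈ p.edges) (x : V → Fin 2) :
    ∏ g ∈ p.edges.toFinset.erase e, edgeSpin x g = edgeSpin x e * edgeSpin x s(i, k) := by
  rw [← prod_edgeSpin_toFinset_edges hp, ← mul_prod_erase _ _ (List.mem_toFinset.2 he),
    ← mul_assoc, edgeSpin_mul_self, one_mul]

theorem edgeSpin_eq_prod_toFinset [DecidableEq V] {e : Sym2 V} (he : ¬e.IsDiag) (x : V → Fin 2) :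
    edgeSpin x e = ∏ i ∈ e.toFinset, spin (x i) := by
  induction e with
  | h i j => rw [Sym2.toFinset_mk_eq, prod_pair he, edgeSpin_mk]

theorem prod_symmDiff_spin [DecidableEq V] (S U : Finset V) (x : V → Fin 2) :
    ∏ i ∈ symmDiff S U, spin (x i) = (∏ i ∈ S, spin (x i)) * ∏ i ∈ U, spin (x i) := by
  have hinter : (∏ i ∈ S ∩ U, spin (x i)) * ∏ i ∈ S ∩ U, spin (x i) = 1 := by
    simp [← prod_mul_distrib, spin_mul_self]
  rw [symmDiff_def, sup_eq_union, prod_union disjoint_sdiff_sdiff,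
    ← prod_inter_mul_prod_sdiff S U, ← prod_inter_mul_prod_sdiff U S, inter_comm U S]
  linear_combination -(∏ i ∈ S \ U, spin (x i)) * (∏ i ∈ U \ S, spin (x i)) * hinter

open Classical in
/-- Flip the bits of `x` at the vertices in `U`. -/
noncomputable def flipOn (U : Set V) (x : V → Fin 2) (i : V) : Fin 2 :=
  if i ∈ U then x i + 1 else x i

theorem flipOn_involutive (U : Set V) : Function.Involutive (flipOn U) := by
  intro x
  funext i
  by_cases hi : i ∈ U
  · simp [flipOn, hi, add_assoc, show (1 : Fin 2) + 1 = 0 from rfl]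
  · simp [flipOn, hi]

theorem spin_flipOn_of_mem {U : Set V} {i : V} (hi : i ∈ U) (x : V → Fin 2) :
    spin (flipOn U x i) = -spin (x i) := by
  simp [flipOn, hi, spin_add_one]

theorem spin_flipOn_of_notMem {U : Set V} {i : V} (hi : i ∉ U) (x : V → Fin 2) :
    spin (flipOn U x i) = spin (x i) := by
  simp [flipOn, hi]

theorem edgeSpin_flipOn {U : Set V} {i j : V} (h : i ∈ U ↔ j ∈ U) (x : V → Fin 2) :
    edgeSpin (flipOn U x) s(i, j) = edgeSpin x s(i, j) := by
  by_cases hi : i ∈ U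
  · simp [spin_flipOn_of_mem hi, spin_flipOn_of_mem (h.1 hi)]
  · simp [spin_flipOn_of_notMem hi, spin_flipOn_of_notMem (h.not.1 hi)]

theorem sum_eq_zero_of_flipOn_eq_neg [Fintype V] [DecidableEq V] {φ : (V → Fin 2) → ℝ} (U : Set V)
    (hφ : ∀ x, φ (flipOn U x) = -φ x) : ∑ x, φ x = 0 := by
  have h : ∑ x, φ x = -∑ x, φ x := by
    rw [← sum_neg_distrib, ← Equiv.sum_comp (flipOn_involutive U).toPerm]
    exact sum_congr rfl fun x _ ↦ hφ x
  linarith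

theorem sum_edgeSpin_mul_prod_eq_zero [Fintype V] [DecidableEq V] {T : SimpleGraph V}
    (hT : T.IsAcyclic) {F : Finset (Sym2 V)} {e : Sym2 V} (he : e ∈ T.edgeSet) (heF : e ∉ F)
    (hF : ↑F ⊆ T.edgeSet) (α β : Sym2 V → ℝ) :
    ∑ x, edgeSpin x e * ∏ g ∈ F, (α g + β g * edgeSpin x g) = 0 := by
  induction e with | h u v
  -- Flipping the component of `u` in `T` minus the edge `uv` changes no other edge of `T`.
  set U : Set V := {w | (T.deleteEdges {s(u, v)}).Reachable u w}
  refine sum_eq_zero_of_flipOn_eq_neg U fun x ↦ ?_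
  have hprod : ∀ g ∈ F, edgeSpin (flipOn U x) g = edgeSpin x g := by
    intro g hg
    induction g with | h i j
    have hadj : (T.deleteEdges {s(u, v)}).Adj i j :=
      deleteEdges_adj.2 ⟨hF hg, fun h ↦ heF (h ▸ hg)⟩
    exact edgeSpin_flipOn
      ⟨fun hi ↦ hi.trans hadj.reachable, fun hj ↦ hj.trans hadj.symm.reachable⟩ x
  have hu : u ∈ U := Reachable.refl u
  have hv : v ∉ U := isAcyclic_iff_forall_adj_isBridge.1 hT he
  rw [prod_congr rfl fun g hg ↦ by rw [hprod g hg], edgeSpin_mk, edgeSpin_mk,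
    spin_flipOn_of_mem hu, spin_flipOn_of_notMem hv]
  ring

theorem sum_prod_add_mul_edgeSpin [Fintype V] [DecidableEq V] {T : SimpleGraph V} (hT : T.IsAcyclic)
    {F : Finset (Sym2 V)} (hF : ↑F ⊆ T.edgeSet) (α β : Sym2 V → ℝ) :
    ∑ x, ∏ e ∈ F, (α e + β e * edgeSpin x e) = 2 ^ Fintype.card V * ∏ e ∈ F, α e := by
  induction F using Finset.induction_on with
  | empty => simp
  | insert e F he ih =>
    rw [coe_insert, Set.insert_subset_iff] at hF
    have hflip := sum_edgeSpin_mul_prod_eq_zero hT hF.1 he hF.2 α β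
    simp only [prod_insert he, add_mul, sum_add_distrib, mul_assoc, ← mul_sum, hflip, ih hF.2]
    ring

end Spins

section Ising

variable {V : Type*} [Fintype V] {ρ : ℝ} {F S : Finset (Sym2 V)} {T : SimpleGraph V}

/-- The law on `{0,1}^V` with density `∏_{e ∈ F} (1 + ρ x_e)` with respect to the uniform law, where
`x_e = ± 1` is the spin of `e`. If `F` is a forest, it is the Ising model on `F` with uniform
marginals in which adjacent spins have correlation `ρ`. -/
noncomputable def isingWeight (ρ : ℝ) (F : Finset (Sym2 V)) (x : V → Fin 2) : ℝ :=
  (1 / 2) ^ Fintype.card V * ∏ e ∈ F, (1 + ρ * edgeSpin x e)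

theorem isingWeight_nonneg (hρ : |ρ| ≤ 1) (F : Finset (Sym2 V)) (x : V → Fin 2) :
    0 ≤ isingWeight ρ F x := by
  refine mul_nonneg (by positivity) (prod_nonneg fun e _ ↦ ?_)
  have hle : |ρ * edgeSpin x e| ≤ 1 := by rwa [abs_mul, abs_edgeSpin, mul_one]
  linarith [(abs_le.1 hle).1]

variable [DecidableEq V]

theorem sum_prod_edgeSpin_mul_isingWeight (hT : T.IsAcyclic) (hF : ↑F ⊆ T.edgeSet)
    (hS : S ⊆ F) : ∑ x, (∏ e ∈ S, edgeSpin x e) * isingWeight ρ F x = ρ ^ #S := by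
  have habsorb : ∀ x : V → Fin 2, (∏ e ∈ S, edgeSpin x e) * ∏ e ∈ F, (1 + ρ * edgeSpin x e) =
      ∏ e ∈ F, ((if e ∈ S then ρ else 1) + (if e ∈ S then 1 else ρ) * edgeSpin x e) := by
    intro x
    rw [← inter_eq_right.2 hS, ← prod_ite_mem, ← prod_mul_distrib]
    refine prod_congr rfl fun e he ↦ ?_
    by_cases heS : e ∈ S
    · simp only [heS, he, mem_inter, and_self, if_true]
      linear_combination ρ * edgeSpin_mul_self x e
    · simp [heS]
  simp only [isingWeight, mul_left_comm _ ((1 / 2 : ℝ) ^ _), ← mul_sum, habsorb,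
    sum_prod_add_mul_edgeSpin hT hF, prod_ite_mem, inter_eq_right.2 hS, prod_const]
  rw [← mul_assoc, ← mul_pow]
  norm_num

theorem sum_isingWeight (hT : T.IsAcyclic) (hF : ↑F ⊆ T.edgeSet) :
    ∑ x, isingWeight ρ F x = 1 := by
  simpa using sum_prod_edgeSpin_mul_isingWeight (ρ := ρ) hT hF (empty_subset F)

theorem sum_edgeSpin_mul_isingWeight (hT : T.IsAcyclic) (hF : ↑F ⊆ T.edgeSet) {e : Sym2 V}
    (he : e ∈ F) : ∑ x, edgeSpin x e * isingWeight ρ F x = ρ := by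
  simpa using sum_prod_edgeSpin_mul_isingWeight (ρ := ρ) hT hF (singleton_subset_iff.2 he)

theorem sum_spin_mul_isingWeight (ρ : ℝ) (F : Finset (Sym2 V)) (i : V) :
    ∑ x, spin (x i) * isingWeight ρ F x = 0 := by
  refine sum_eq_zero_of_flipOn_eq_neg Set.univ fun x ↦ ?_
  have hedge : ∀ e : Sym2 V, edgeSpin (flipOn Set.univ x) e = edgeSpin x e := fun e ↦ by
    induction e with | h i j => exact edgeSpin_flipOn (by simp) x
  simp only [isingWeight, hedge, spin_flipOn_of_mem (Set.mem_univ i), neg_mul]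

end Ising

section Paths

variable {V : Type*} {G : SimpleGraph V} {i k : V} {e f : Sym2 V}

theorem two_le_length_of_mem_edges_of_ne {p : G.Walk i k} (he : e ∈ p.edges)
    (hne : s(i, k) ≠ e) : 2 ≤ p.length := by
  match p with
  | .nil => simp at he
  | .cons _ .nil => simp_all
  | .cons _ (.cons _ _) => simp

variable [DecidableEq V]

theorem coe_toFinset_edges_subset (w : G.Walk i k) : ↑w.edges.toFinset ⊆ G.edgeSet :=
  fun _ hg ↦ w.edges_subset_edgeSet (List.mem_toFinset.1 hg)

theorem card_toFinset_edges {w : G.Walk i k} (hw : w.IsPath) : #w.edges.toFinset = w.length := by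
  rw [List.toFinset_card_of_nodup hw.isTrail.edges_nodup, Walk.length_edges]

theorem three_le_length_of_mem_edges_of_disjoint {p : G.Walk i k} (he : e ∈ p.edges)
    (hdisj : Disjoint e.toFinset s(i, k).toFinset) : 3 ≤ p.length := by
  have hi : i ∉ e := fun h ↦ disjoint_left.1 hdisj (Sym2.mem_toFinset.2 h) (by simp)
  have hk : k ∉ e := fun h ↦ disjoint_left.1 hdisj (Sym2.mem_toFinset.2 h) (by simp)
  match p with
  | .nil => simp at he
  | .cons _ .nil => simp_all
  | .cons _ (.cons _ .nil) => aesop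
  | .cons _ (.cons _ (.cons _ _)) => simp

theorem card_symmDiff_toFinset (he : ¬e.IsDiag) (hf : ¬f.IsDiag) (hne : f ≠ e) :
    #(symmDiff e.toFinset f.toFinset) = 2 ∨
      #(symmDiff e.toFinset f.toFinset) = 4 ∧ Disjoint e.toFinset f.toFinset := by
  have hcard_e := Sym2.card_toFinset_of_not_isDiag e he
  have hcard_f := Sym2.card_toFinset_of_not_isDiag f hf
  have hinter : #(e.toFinset ∩ f.toFinset) < 2 := by
    by_contra! h
    have hsub : e.toFinset = f.toFinset :=
      (eq_of_subset_of_card_le inter_subset_left (hcard_e.trans_le h)).symm.trans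
        (eq_of_subset_of_card_le inter_subset_right (hcard_f.trans_le h))
    exact hne (Sym2.ext fun x ↦ by rw [← Sym2.mem_toFinset, ← hsub, Sym2.mem_toFinset])
  have hsdiff_e := card_sdiff_add_card_inter e.toFinset f.toFinset
  have hsdiff_f := card_sdiff_add_card_inter f.toFinset e.toFinset
  rw [inter_comm] at hsdiff_f
  rw [symmDiff_def, sup_eq_union, card_union_of_disjoint disjoint_sdiff_sdiff,
    disjoint_iff_inter_eq_empty, ← card_eq_zero]
  lia

end Paths

section Marginals

variable {p : ℕ} {θ : ℝ} {Q P : (Fin p → Fin 2) → ℝ} {T : SimpleGraph (Fin p)}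

theorem nodeMarginal_eq_sum_spin (Q : (Fin p → Fin 2) → ℝ) (i : Fin p) (a : Fin 2) :
    nodeMarginal Q i a = (∑ x, Q x + spin a * ∑ x, spin (x i) * Q x) / 2 := by
  rw [nodeMarginal, sum_filter, mul_sum, ← sum_add_distrib, sum_div]
  refine sum_congr rfl fun x _ ↦ ?_
  rw [← mul_boole, ite_eq_spin]
  ring

theorem pairMarginal_eq_sum_spin (Q : (Fin p → Fin 2) → ℝ) (i j : Fin p) (a b : Fin 2) :
    pairMarginal Q i j a b = (∑ x, Q x + spin a * ∑ x, spin (x i) * Q x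
      + spin b * ∑ x, spin (x j) * Q x + spin a * spin b * ∑ x, edgeSpin x s(i, j) * Q x) / 4 := by
  rw [pairMarginal, sum_filter, mul_sum, mul_sum, mul_sum, ← sum_add_distrib, ← sum_add_distrib,
    ← sum_add_distrib, sum_div]
  refine sum_congr rfl fun x _ ↦ ?_
  rw [ite_and, ← mul_boole, ← mul_boole, ite_eq_spin, ite_eq_spin, edgeSpin_mk]
  ring

theorem nodeMarginal_eq_sum_pairMarginal (Q : (Fin p → Fin 2) → ℝ) (i j : Fin p) (a : Fin 2) :
    nodeMarginal Q i a = pairMarginal Q i j a 0 + pairMarginal Q i j a 1 := by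
  rw [nodeMarginal_eq_sum_spin, pairMarginal_eq_sum_spin, pairMarginal_eq_sum_spin]
  simp only [spin, if_true, one_ne_zero, if_false]
  ring

theorem pairMarginal_of_uniform (hunif : ∀ i a, nodeMarginal Q i a = 1 / 2) {i j : Fin p}
    (hpair : pairMarginal Q i j 0 1 = θ / 2 ∧ pairMarginal Q i j 1 0 = θ / 2) (a b : Fin 2) :
    pairMarginal Q i j a b = (1 + (1 - 2 * θ) * (spin a * spin b)) / 4 := by
  have h0 := nodeMarginal_eq_sum_pairMarginal Q i j 0
  have h1 := nodeMarginal_eq_sum_pairMarginal Q i j 1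
  rw [hunif] at h0 h1
  fin_cases a <;> fin_cases b <;> simp [spin] <;> linarith

theorem edgeFactor_of_uniform (hunif : ∀ i a, nodeMarginal Q i a = 1 / 2) {i j : Fin p}
    (hpair : pairMarginal Q i j 0 1 = θ / 2 ∧ pairMarginal Q i j 1 0 = θ / 2)
    (x : Fin p → Fin 2) :
    edgeFactor Q x s(i, j) = 1 + (1 - 2 * θ) * edgeSpin x s(i, j) := by
  change pairMarginal Q i j (x i) (x j) / (nodeMarginal Q i (x i) * nodeMarginal Q j (x j)) = _
  rw [pairMarginal_of_uniform hunif hpair, hunif, hunif, edgeSpin_mk]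
  ring

theorem prod_nodeMarginal_mul_prod_edgeFactor [Fintype T.edgeSet]
    (hunif : ∀ i a, nodeMarginal Q i a = 1 / 2)
    (hpair : ∀ i j, T.Adj i j → pairMarginal Q i j 0 1 = θ / 2 ∧ pairMarginal Q i j 1 0 = θ / 2)
    (x : Fin p → Fin 2) :
    (∏ i, nodeMarginal Q i (x i)) * ∏ e ∈ T.edgeFinset, edgeFactor Q x e =
      isingWeight (1 - 2 * θ) T.edgeFinset x := by
  rw [isingWeight, prod_congr rfl fun i _ ↦ hunif i (x i), prod_const, card_univ]
  congr 1
  refine prod_congr rfl fun e he ↦ ?_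
  induction e with
  | h i j => exact edgeFactor_of_uniform hunif (hpair i j (mem_edgeFinset.1 he)) x

theorem IsTreeModel.eq_isingWeight [Fintype T.edgeSet] (hP : IsTreeModel θ T P) :
    P = isingWeight (1 - 2 * θ) T.edgeFinset := by
  funext x
  rw [hP.factorizes x, ← prod_nodeMarginal_mul_prod_edgeFactor hP.uniform hP.homogeneous x]
  congr!

theorem isTreeModel_isingWeight [Fintype T.edgeSet] (hT : T.IsTree) (hθ₀ : 0 ≤ θ) (hθ₁ : θ ≤ 1) :
    IsTreeModel θ T (isingWeight (1 - 2 * θ) T.edgeFinset) := by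
  have hF : ↑T.edgeFinset ⊆ T.edgeSet := (coe_edgeFinset T).subset
  have hsum := sum_isingWeight (ρ := 1 - 2 * θ) hT.isAcyclic hF
  have hunif : ∀ i a, nodeMarginal (isingWeight (1 - 2 * θ) T.edgeFinset) i a = 1 / 2 := by
    intro i a
    rw [nodeMarginal_eq_sum_spin, hsum, sum_spin_mul_isingWeight, mul_zero, add_zero]
  have hpair : ∀ i j, T.Adj i j →
      pairMarginal (isingWeight (1 - 2 * θ) T.edgeFinset) i j 0 1 = θ / 2 ∧
        pairMarginal (isingWeight (1 - 2 * θ) T.edgeFinset) i j 1 0 = θ / 2 := by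
    intro i j hij
    simp only [pairMarginal_eq_sum_spin, hsum, sum_spin_mul_isingWeight,
      sum_edgeSpin_mul_isingWeight hT.isAcyclic hF (mem_edgeFinset.2 ((mem_edgeSet T).2 hij))]
    norm_num [spin]
    ring
  refine ⟨hT, ⟨isingWeight_nonneg (abs_le.2 ⟨by linarith, by linarith⟩) _, hsum⟩, fun x ↦ ?_,
    hunif, hpair⟩
  rw [← prod_nodeMarginal_mul_prod_edgeFactor hunif hpair]
  congr!

end Marginals

section Channel

variable {p : ℕ}

theorem bscOutput_zero (P : (Fin p → Fin 2) → ℝ) : bscOutput 0 P = P := by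
  funext y
  rw [bscOutput, sum_eq_single y (fun x _ hxy ↦ by simp [hxy]) (by simp)]
  simp

theorem pow_hammingDist_mul_pow (q : ℝ) (x y : Fin p → Fin 2) :
    q ^ hammingDist x y * (1 - q) ^ (p - hammingDist x y) =
      ∏ i, if x i = y i then 1 - q else q := by
  have hcard : p - hammingDist x y = #{i | x i = y i} := by
    have h := card_filter_add_card_filter_not (s := (univ : Finset (Fin p))) (fun i ↦ x i = y i)
    rw [card_univ, Fintype.card_fin] at h
    exact Nat.sub_eq_of_eq_add h.symm
  rw [hcard, prod_ite, prod_const, prod_const, mul_comm]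
  rfl

theorem sum_spin_mul_crossover (q : ℝ) (a : Fin 2) :
    ∑ b, spin b * (if a = b then 1 - q else q) = (1 - 2 * q) * spin a := by
  fin_cases a <;> simp [spin] <;> ring

theorem sum_prod_spin_mul_crossover (q : ℝ) (S : Finset (Fin p)) (x : Fin p → Fin 2) :
    ∑ y : Fin p → Fin 2, (∏ i ∈ S, spin (y i)) * ∏ i, (if x i = y i then 1 - q else q) =
      (1 - 2 * q) ^ #S * ∏ i ∈ S, spin (x i) := by
  have hsite : ∀ i, ∑ b, (if i ∈ S then spin b else 1) * (if x i = b then 1 - q else q) =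
      if i ∈ S then (1 - 2 * q) * spin (x i) else 1 := by
    intro i
    split_ifs
    · exact sum_spin_mul_crossover q (x i)
    · rw [Fin.sum_univ_two]
      generalize x i = a
      fin_cases a <;> simp
  calc ∑ y : Fin p → Fin 2, (∏ i ∈ S, spin (y i)) * ∏ i, (if x i = y i then 1 - q else q)
    _ = ∑ y : Fin p → Fin 2,
          ∏ i, (if i ∈ S then spin (y i) else 1) * (if x i = y i then 1 - q else q) := by
        simp only [prod_mul_distrib, prod_ite_mem, univ_inter]
    _ = ∏ i, ∑ b, (if i ∈ S then spin b else 1) * (if x i = b then 1 - q else q) := by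
        rw [← Fintype.piFinset_univ, prod_univ_sum]
    _ = (1 - 2 * q) ^ #S * ∏ i ∈ S, spin (x i) := by
        simp only [hsite, prod_ite_mem, univ_inter, prod_mul_distrib, prod_const]

theorem sum_prod_spin_mul_bscOutput (q : ℝ) (P : (Fin p → Fin 2) → ℝ) (S : Finset (Fin p)) :
    ∑ y, (∏ i ∈ S, spin (y i)) * bscOutput q P y =
      (1 - 2 * q) ^ #S * ∑ x, (∏ i ∈ S, spin (x i)) * P x := by
  simp only [bscOutput, pow_hammingDist_mul_pow, mul_sum]
  rw [sum_comm]
  refine sum_congr rfl fun x _ ↦ ?_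
  simp only [← mul_assoc, ← sum_mul, sum_prod_spin_mul_crossover]

theorem sum_bscOutput (q : ℝ) (P : (Fin p → Fin 2) → ℝ) : ∑ y, bscOutput q P y = ∑ x, P x := by
  simpa using sum_prod_spin_mul_bscOutput q P ∅

theorem sum_edgeSpin_mul_bscOutput (q : ℝ) (P : (Fin p → Fin 2) → ℝ) {e : Sym2 (Fin p)}
    (he : ¬e.IsDiag) :
    ∑ y, edgeSpin y e * bscOutput q P y = (1 - 2 * q) ^ 2 * ∑ x, edgeSpin x e * P x := by
  simpa only [edgeSpin_eq_prod_toFinset he, Sym2.card_toFinset_of_not_isDiag e he] using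
    sum_prod_spin_mul_bscOutput q P e.toFinset

theorem sum_edgeSpin_mul_edgeSpin_mul_bscOutput (q : ℝ) (P : (Fin p → Fin 2) → ℝ)
    {e f : Sym2 (Fin p)} (he : ¬e.IsDiag) (hf : ¬f.IsDiag) :
    ∑ y, edgeSpin y e * edgeSpin y f * bscOutput q P y =
      (1 - 2 * q) ^ #(symmDiff e.toFinset f.toFinset) *
        ∑ x, edgeSpin x e * edgeSpin x f * P x := by
  simpa only [edgeSpin_eq_prod_toFinset he, edgeSpin_eq_prod_toFinset hf, prod_symmDiff_spin] using
    sum_prod_spin_mul_bscOutput q P (symmDiff e.toFinset f.toFinset)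

end Channel

/-- The increment of the walk comparing the numbers of agreements on `e` and on `f`, shifted by `1`:
the walk goes up (`2`) when only `f` agrees, down (`0`) when only `e` agrees, and rests (`1`)
otherwise. -/
def crossingStep {V : Type*} [DecidableEq V] (e f : Sym2 V) (y : V → Fin 2) : ℕ :=
  (if (f.map y).IsDiag then 1 else 0) + if (e.map y).IsDiag then 0 else 1

section StepLaw

variable {V : Type*} [DecidableEq V] {e f : Sym2 V}

theorem crossingStep_le_two (e f : Sym2 V) (y : V → Fin 2) : crossingStep e f y ≤ 2 := by
  rw [crossingStep]
  split_ifs <;> lia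

theorem crossingStep_add_ite_isDiag (y : V → Fin 2) :
    (crossingStep e f y : ℝ) + (if (e.map y).IsDiag then 1 else 0) =
      (if (f.map y).IsDiag then 1 else 0) + 1 := by
  rw [crossingStep]
  split_ifs <;> norm_num

theorem ite_crossingStep_eq_two (y : V → Fin 2) :
    (if crossingStep e f y = 2 then 1 else 0 : ℝ) =
      (1 - edgeSpin y e) / 2 * ((1 + edgeSpin y f) / 2) := by
  rw [show (1 - edgeSpin y e) / 2 = 1 - (1 + edgeSpin y e) / 2 by ring, ← ite_isDiag_map,
    ← ite_isDiag_map, crossingStep]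
  split_ifs <;> simp_all

theorem ite_crossingStep_eq_zero (y : V → Fin 2) :
    (if crossingStep e f y = 0 then 1 else 0 : ℝ) =
      (1 + edgeSpin y e) / 2 * ((1 - edgeSpin y f) / 2) := by
  rw [show (1 - edgeSpin y f) / 2 = 1 - (1 + edgeSpin y f) / 2 by ring, ← ite_isDiag_map,
    ← ite_isDiag_map, crossingStep]
  split_ifs <;> simp_all

variable [Fintype V]

theorem sum_filter_crossingStep_eq_two (D : (V → Fin 2) → ℝ) :
    ∑ y with crossingStep e f y = 2, D y = (∑ y, D y - ∑ y, edgeSpin y e * D y +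
      ∑ y, edgeSpin y f * D y - ∑ y, edgeSpin y e * edgeSpin y f * D y) / 4 := by
  rw [sum_filter, ← sum_sub_distrib, ← sum_add_distrib, ← sum_sub_distrib, sum_div]
  refine sum_congr rfl fun y _ ↦ ?_
  rw [← mul_boole, ite_crossingStep_eq_two]
  ring

theorem sum_filter_crossingStep_eq_zero (D : (V → Fin 2) → ℝ) :
    ∑ y with crossingStep e f y = 0, D y = (∑ y, D y + ∑ y, edgeSpin y e * D y -
      ∑ y, edgeSpin y f * D y - ∑ y, edgeSpin y e * edgeSpin y f * D y) / 4 := by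
  rw [sum_filter, ← sum_add_distrib, ← sum_sub_distrib, ← sum_sub_distrib, sum_div]
  refine sum_congr rfl fun y _ ↦ ?_
  rw [← mul_boole, ite_crossingStep_eq_zero]
  ring

end StepLaw

section Moments

variable {p : ℕ} {θ : ℝ} {P : (Fin p → Fin 2) → ℝ} {T : SimpleGraph (Fin p)} {i k : Fin p}
  {e f : Sym2 (Fin p)}

theorem IsTreeModel.sum_prod_edgeSpin (hP : IsTreeModel θ T P) {S : Finset (Sym2 (Fin p))}
    (hS : ↑S ⊆ T.edgeSet) : ∑ x, (∏ e ∈ S, edgeSpin x e) * P x = (1 - 2 * θ) ^ #S := by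
  classical
  rw [hP.eq_isingWeight]
  exact sum_prod_edgeSpin_mul_isingWeight hP.isTree.isAcyclic (coe_edgeFinset T).subset
    fun e he ↦ mem_edgeFinset.2 (hS he)

theorem IsTreeModel.sum_edgeSpin_of_mem_edgeSet (hP : IsTreeModel θ T P) (he : e ∈ T.edgeSet) :
    ∑ x, edgeSpin x e * P x = 1 - 2 * θ := by
  simpa using hP.sum_prod_edgeSpin (S := {e}) (by simpa using he)

theorem IsTreeModel.sum_edgeSpin_of_isPath (hP : IsTreeModel θ T P) {w : T.Walk i k}
    (hw : w.IsPath) : ∑ x, edgeSpin x s(i, k) * P x = (1 - 2 * θ) ^ w.length := by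
  simp only [← prod_edgeSpin_toFinset_edges hw, hP.sum_prod_edgeSpin (coe_toFinset_edges_subset w),
    card_toFinset_edges hw]

theorem IsTreeModel.sum_edgeSpin_mul_edgeSpin_of_isPath (hP : IsTreeModel θ T P)
    {w : T.Walk i k} (hw : w.IsPath) (he : e ∈ w.edges) :
    ∑ x, edgeSpin x e * edgeSpin x s(i, k) * P x = (1 - 2 * θ) ^ (w.length - 1) := by
  have hsub : ↑(w.edges.toFinset.erase e) ⊆ T.edgeSet :=
    (coe_subset.2 (erase_subset _ _)).trans (coe_toFinset_edges_subset w)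
  simp only [← prod_edgeSpin_erase_edges hw he, hP.sum_prod_edgeSpin hsub,
    card_erase_of_mem (List.mem_toFinset.2 he), card_toFinset_edges hw]

theorem IsTreeModel.sum_bscOutput_eq_one (hP : IsTreeModel θ T P) (q : ℝ) :
    ∑ y, bscOutput q P y = 1 :=
  (sum_bscOutput q P).trans hP.mem_stdSimplex.2

theorem IsTreeModel.sum_edgeSpin_mul_bscOutput_of_mem_edgeSet (hP : IsTreeModel θ T P)
    (he : e ∈ T.edgeSet) (q : ℝ) :
    ∑ y, edgeSpin y e * bscOutput q P y = (1 - 2 * q) ^ 2 * (1 - 2 * θ) := by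
  rw [sum_edgeSpin_mul_bscOutput q P (T.not_isDiag_of_mem_edgeSet he),
    hP.sum_edgeSpin_of_mem_edgeSet he]

/-- Here `l + 1` is the length of the path of `T` between the ends of `f`. The second alternative
covers the disjoint pairs `e`, `f`. -/
theorem IsTreeModel.exists_length_of_isCrossing (hP : IsTreeModel θ T P)
    (hef : IsCrossing T e f) (q : ℝ) : ∃ l,
    ∑ y, edgeSpin y f * bscOutput q P y = (1 - 2 * q) ^ 2 * (1 - 2 * θ) ^ (l + 1) ∧
      (1 ≤ l ∧ ∑ y, edgeSpin y e * edgeSpin y f * bscOutput q P y =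
          (1 - 2 * q) ^ 2 * (1 - 2 * θ) ^ l ∨
        2 ≤ l ∧ ∑ y, edgeSpin y e * edgeSpin y f * bscOutput q P y =
          (1 - 2 * q) ^ 4 * (1 - 2 * θ) ^ l) := by
  have he_diag := T.not_isDiag_of_mem_edgeSet hef.mem_edgeSet
  have hf_diag := hef.not_isDiag
  obtain ⟨i, k, w, hw, rfl, he, hne⟩ := hef
  have hlength := two_le_length_of_mem_edges_of_ne he hne
  refine ⟨w.length - 1, ?_, ?_⟩
  · rw [sum_edgeSpin_mul_bscOutput q P hf_diag, hP.sum_edgeSpin_of_isPath hw,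
      Nat.sub_add_cancel (by lia)]
  rw [sum_edgeSpin_mul_edgeSpin_mul_bscOutput q P he_diag hf_diag,
    hP.sum_edgeSpin_mul_edgeSpin_of_isPath hw he]
  rcases card_symmDiff_toFinset he_diag hf_diag hne with h | ⟨h, hdisj⟩
  · exact .inl ⟨by lia, by rw [h]⟩
  · have := three_le_length_of_mem_edges_of_disjoint he hdisj
    exact .inr ⟨by lia, by rw [h]⟩

end Moments

section GeneratingPolynomials

variable {α R : Type*} [Fintype α]

/-- The generating polynomial `∑ y, D y * X ^ g y` of the function `g` under the weights `D`. -/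
noncomputable def genPoly (D : α → ℝ) (g : α → ℕ) : ℝ[X] := ∑ y, monomial (g y) (D y)

theorem coeff_genPoly (D : α → ℝ) (g : α → ℕ) (j : ℕ) :
    (genPoly D g).coeff j = ∑ y with g y = j, D y := by
  simp only [genPoly, finsetSum_coeff, coeff_monomial, sum_filter]

/-- The generating polynomial of a step with weight `a` up, `b` down and `c` at rest, where the
steps are shifted by `1` so as to take the values `2`, `0` and `1`. -/
noncomputable def stepPoly (a b c : ℝ) : ℝ[X] := C a * X ^ 2 + C c * X + C b

theorem coeff_stepPoly_two (a b c : ℝ) : (stepPoly a b c).coeff 2 = a := by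
  simp [stepPoly]

theorem eval_stepPoly (a b c r : ℝ) : (stepPoly a b c).eval r = a * r ^ 2 + c * r + b := by
  simp [stepPoly]

theorem genPoly_eq_stepPoly (D : α → ℝ) {g : α → ℕ} (hg : ∀ y, g y ≤ 2) :
    genPoly D g = stepPoly (∑ y with g y = 2, D y) (∑ y with g y = 0, D y)
      (∑ y, D y - ∑ y with g y = 2, D y - ∑ y with g y = 0, D y) := by
  simp only [genPoly, stepPoly, sum_filter, ← sum_sub_distrib, map_sum, sum_mul,
    ← sum_add_distrib]
  refine sum_congr rfl fun y _ ↦ ?_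
  have := hg y
  interval_cases g y <;> simp [← C_mul_X_pow_eq_monomial]

theorem sq_eval_one_le_mul_coeff_mul_self [CommRing R] [LinearOrder R]
    [IsStrictOrderedRing R] {f : R[X]} (hf : f.reverse = f) :
    f.eval 1 ^ 2 ≤ (f.natDegree + 1) * (f * f).coeff f.natDegree := by
  have hsymm : ∀ j ≤ f.natDegree, f.coeff (f.natDegree - j) = f.coeff j := by
    intro j hj
    conv_rhs => rw [← hf, coeff_reverse, revAt_le hj]
  have hmiddle : (f * f).coeff f.natDegree = ∑ j ∈ range (f.natDegree + 1), f.coeff j ^ 2 := by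
    rw [coeff_mul, Nat.sum_antidiagonal_eq_sum_range_succ_mk]
    refine sum_congr rfl fun j hj ↦ ?_
    rw [hsymm j (mem_range_succ_iff.1 hj), sq]
  rw [hmiddle, eval_eq_sum_range]
  simpa using sq_sum_le_card_mul_sum_sq (s := range (f.natDegree + 1)) (f := f.coeff)

variable {a b c r t : ℝ}

theorem natDegree_stepPoly (ha : a ≠ 0) : (stepPoly a b c).natDegree = 2 := by
  rw [stepPoly]
  compute_degree!

theorem coeff_stepPoly_nonneg (ha : 0 ≤ a) (hb : 0 ≤ b) (hc : 0 ≤ c) (j : ℕ) :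
    0 ≤ (stepPoly a b c).coeff j := by
  simp only [stepPoly, coeff_add, coeff_C_mul, coeff_X_pow, coeff_X, coeff_C]
  positivity

theorem reverse_stepPoly (ht : t ≠ 0) : (stepPoly t t c).reverse = stepPoly t t c := by
  rw [reverse, natDegree_stepPoly ht]
  have hX : reflect 2 (X : ℝ[X]) = X := by
    simpa [revAt_le] using reflect_monomial (R := ℝ) 2 1
  simp only [stepPoly, reflect_add, reflect_C_mul, reflect_C, hX, reflect_monomial,
    revAt_le le_rfl, Nat.sub_self, pow_zero]
  ring

theorem pow_le_mul_coeff_stepPoly_pow_of_symm (ht : t ≠ 0) (c : ℝ) (m : ℕ) :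
    (c + 2 * t) ^ (2 * m) ≤ (2 * m + 1) * (stepPoly t t c ^ (2 * m)).coeff (2 * m) := by
  have hrev : (stepPoly t t c ^ m).reverse = stepPoly t t c ^ m := by
    induction m with
    | zero => simpa using reverse_C (1 : ℝ)
    | succ m ih => rw [pow_succ, reverse_mul_of_domain, ih, reverse_stepPoly ht]
  have hcoeff := sq_eval_one_le_mul_coeff_mul_self hrev
  rw [natDegree_pow, natDegree_stepPoly ht, eval_pow, eval_stepPoly, ← pow_mul, ← pow_add,
    ← two_mul, mul_comm m 2] at hcoeff
  push_cast at hcoeff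
  linear_combination hcoeff

theorem stepPoly_comp_C_mul_X (hr : a * r ^ 2 = b) :
    (stepPoly a b c).comp (C r * X) = C r * stepPoly (a * r) (a * r) c := by
  simp only [stepPoly, add_comp, mul_comp, pow_comp, X_comp, C_comp, ← hr, map_mul, map_pow]
  ring

theorem pow_le_mul_coeff_stepPoly_pow (ha : a ≠ 0) (hr₀ : 0 < r) (hr : a * r ^ 2 = b) (c : ℝ)
    (m : ℕ) : (c + 2 * (a * r)) ^ (2 * m) ≤
      (2 * m + 1) * (stepPoly a b c ^ (2 * m)).coeff (2 * m) := by
  -- Substituting `r * X` for `X` makes the polynomial palindromic.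
  have htilt : (stepPoly a b c ^ (2 * m)).coeff (2 * m) =
      (stepPoly (a * r) (a * r) c ^ (2 * m)).coeff (2 * m) := by
    have h := congrArg (fun f : ℝ[X] ↦ (f ^ (2 * m)).coeff (2 * m))
      (stepPoly_comp_C_mul_X (c := c) hr)
    simp only [← pow_comp, comp_C_mul_X_coeff, mul_pow, ← C_pow, coeff_C_mul] at h
    exact mul_right_cancel₀ (pow_pos hr₀ _).ne' (h.trans (mul_comm _ _))
  rw [htilt]
  exact pow_le_mul_coeff_stepPoly_pow_of_symm (mul_ne_zero ha hr₀.ne') c m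

theorem coeff_pow_nonneg [CommSemiring R] [PartialOrder R] [IsOrderedRing R] {f : R[X]}
    (hf : ∀ j, 0 ≤ f.coeff j) (n j : ℕ) :
    0 ≤ (f ^ n).coeff j := by
  induction n generalizing j with
  | zero =>
    rw [pow_zero, coeff_one]
    split_ifs
    exacts [zero_le_one, le_rfl]
  | succ n ih =>
    rw [pow_succ, coeff_mul]
    exact sum_nonneg fun x _ ↦ mul_nonneg (ih _) (hf _)

theorem coeff_mul_coeff_le_coeff_mul [CommSemiring R] [PartialOrder R] [IsOrderedRing R]
    {f g : R[X]} (hf : ∀ j, 0 ≤ f.coeff j) (hg : ∀ j, 0 ≤ g.coeff j) (k l : ℕ) :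
    f.coeff k * g.coeff l ≤ (f * g).coeff (k + l) := by
  rw [coeff_mul]
  exact single_le_sum (f := fun x : ℕ × ℕ ↦ f.coeff x.1 * g.coeff x.2)
    (fun x _ ↦ mul_nonneg (hf _) (hg _)) (mem_antidiagonal.2 rfl : (k, l) ∈ antidiagonal (k + l))

theorem exists_lt_le_coeff_stepPoly_pow (ha₀ : 0 < a) (ha₁ : a ≤ 1) (hb : 0 ≤ b) (hc : 0 ≤ c)
    (hr₀ : 0 < r) (hr : a * r ^ 2 = b) (hG : c + 2 * (a * r) ≤ 1) {n : ℕ} (hn : n ≠ 0) :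
    ∃ j, n < j ∧ a ^ 2 * ((c + 2 * (a * r)) ^ n / (n + 1)) ≤ (stepPoly a b c ^ n).coeff j := by
  have hcoeff := coeff_stepPoly_nonneg ha₀.le hb hc
  -- An even number `2 * m` of steps returning to the origin, then `l ≤ 2` steps up.
  obtain ⟨m, l, hl₀, hl₂, rfl⟩ : ∃ m l, 1 ≤ l ∧ l ≤ 2 ∧ n = 2 * m + l :=
    ⟨(n - 1) / 2, n - 2 * ((n - 1) / 2), by lia, by lia, by lia⟩
  refine ⟨2 * m + 2 * l, by lia, ?_⟩
  have hreturn : (c + 2 * (a * r)) ^ (2 * m + l) / ((2 * m + l : ℕ) + 1) ≤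
      (stepPoly a b c ^ (2 * m)).coeff (2 * m) := by
    rw [div_le_iff₀' (by positivity)]
    calc (c + 2 * (a * r)) ^ (2 * m + l) ≤ (c + 2 * (a * r)) ^ (2 * m) :=
          pow_le_pow_of_le_one (by positivity) hG (by lia)
      _ ≤ (2 * m + 1) * (stepPoly a b c ^ (2 * m)).coeff (2 * m) :=
          pow_le_mul_coeff_stepPoly_pow ha₀.ne' hr₀ hr c m
      _ ≤ ((2 * m + l : ℕ) + 1) * (stepPoly a b c ^ (2 * m)).coeff (2 * m) := by
          have := coeff_pow_nonneg hcoeff (2 * m) (2 * m)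
          gcongr
          push_cast
          simp
  have hup : a ^ 2 ≤ (stepPoly a b c ^ l).coeff (2 * l) := by
    calc a ^ 2 ≤ a ^ l := pow_le_pow_of_le_one ha₀.le ha₁ hl₂
      _ = (stepPoly a b c ^ l).coeff (2 * l) := by
        rw [← natDegree_stepPoly (b := b) (c := c) ha₀.ne', mul_comm, coeff_pow_mul_natDegree,
          leadingCoeff, natDegree_stepPoly ha₀.ne', coeff_stepPoly_two]
  calc a ^ 2 * ((c + 2 * (a * r)) ^ (2 * m + l) / ((2 * m + l : ℕ) + 1))
      ≤ (stepPoly a b c ^ l).coeff (2 * l) * (stepPoly a b c ^ (2 * m)).coeff (2 * m) :=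
        mul_le_mul hup hreturn (by positivity) (coeff_pow_nonneg hcoeff _ _)
    _ ≤ (stepPoly a b c ^ (2 * m + l)).coeff (2 * m + 2 * l) := by
        rw [mul_comm, pow_add]
        exact coeff_mul_coeff_le_coeff_mul (coeff_pow_nonneg hcoeff _)
          (coeff_pow_nonneg hcoeff _) _ _

end GeneratingPolynomials

section Sums

variable {Ω : Type*} [MeasurableSpace Ω] {μ : Measure Ω}

theorem measureReal_sum_eq_coeff_pow [IsProbabilityMeasure μ] {Z : ℕ → Ω → ℕ}
    (hmeas : ∀ k, Measurable (Z k)) (hindep : iIndepFun Z μ) {f : ℝ[X]}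
    (hlaw : ∀ k j, μ.real {ω | Z k ω = j} = f.coeff j) (n j : ℕ) :
    μ.real {ω | ∑ k ∈ range n, Z k ω = j} = (f ^ n).coeff j := by
  induction n generalizing j with
  | zero => rcases eq_or_ne j 0 with rfl | hj <;> simp [coeff_one, *, Ne.symm]
  | succ n ih =>
    have hS : Measurable (∑ k ∈ range n, Z k) := by fun_prop
    have hset : {ω | ∑ k ∈ range (n + 1), Z k ω = j} =
        ⋃ x ∈ antidiagonal j, (∑ k ∈ range n, Z k) ⁻¹' {x.1} ∩ Z n ⁻¹' {x.2} := by
      ext ω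
      simp [sum_range_succ]
    have hdisj : Set.PairwiseDisjoint ↑(antidiagonal j)
        fun x : ℕ × ℕ ↦ (∑ k ∈ range n, Z k) ⁻¹' {x.1} ∩ Z n ⁻¹' {x.2} := by
      refine fun x _ y _ hxy ↦ Set.disjoint_left.2 ?_
      rintro ω ⟨hx₁, hx₂⟩ ⟨hy₁, hy₂⟩
      exact hxy (Prod.ext (hx₁.symm.trans hy₁) (hx₂.symm.trans hy₂))
    rw [hset, measureReal_biUnion_finset hdisj fun x _ ↦
      (hS (measurableSet_singleton _)).inter (hmeas n (measurableSet_singleton _)), pow_succ,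
      coeff_mul]
    refine sum_congr rfl fun x _ ↦ ?_
    rw [← ih, ← hlaw n, measureReal_def, (hindep.indepFun_sum_range_succ hmeas
      n).measure_inter_preimage_eq_mul _ _ (measurableSet_singleton _) (measurableSet_singleton _),
      ENNReal.toReal_mul]
    congr 3
    ext ω
    simp

theorem measureReal_le_eval_div_pow [IsFiniteMeasure μ] {S : Ω → ℕ} {f : ℝ[X]}
    (hlaw : ∀ j, μ.real {ω | S ω = j} = f.coeff j) {r : ℝ} (hr : 1 ≤ r) (n : ℕ) :
    μ.real {ω | n ≤ S ω} ≤ f.eval r / r ^ n := by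
  have hr₀ : 0 < r ^ n := pow_pos (by linarith) n
  have hcoeff : ∀ j, 0 ≤ f.coeff j := fun j ↦ hlaw j ▸ measureReal_nonneg
  have hsub : {ω | n ≤ S ω} ⊆ (⋃ j ∈ Icc n f.natDegree, {ω | S ω = j}) ∪
      ⋃ j : Set.Ioi f.natDegree, {ω | S ω = j} := by
    intro ω hω
    rcases le_or_gt (S ω) f.natDegree with h | h
    · exact .inl (by simpa [h] using hω)
    · exact .inr (by simpa using h)
  have hnull : μ.real (⋃ j : Set.Ioi f.natDegree, {ω | S ω = j}) = 0 := by
    rw [measureReal_eq_zero_iff]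
    refine measure_iUnion_null fun j ↦ ?_
    rw [← measureReal_eq_zero_iff, hlaw, coeff_eq_zero_of_natDegree_lt j.2]
  calc μ.real {ω | n ≤ S ω}
      ≤ μ.real (⋃ j ∈ Icc n f.natDegree, {ω | S ω = j}) := by
        refine (measureReal_mono hsub).trans ((measureReal_union_le _ _).trans_eq ?_)
        rw [hnull, add_zero]
    _ ≤ ∑ j ∈ Icc n f.natDegree, f.coeff j :=
        (measureReal_biUnion_finset_le _ _).trans_eq (sum_congr rfl fun j _ ↦ hlaw j)
    _ ≤ ∑ j ∈ Icc n f.natDegree, f.coeff j * r ^ j / r ^ n := by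
        refine sum_le_sum fun j hj ↦ ?_
        rw [le_div_iff₀ hr₀]
        exact mul_le_mul_of_nonneg_left (pow_le_pow_right₀ hr (mem_Icc.1 hj).1) (hcoeff j)
    _ ≤ ∑ j ∈ range (f.natDegree + 1), f.coeff j * r ^ j / r ^ n := by
        refine sum_le_sum_of_subset_of_nonneg (fun j hj ↦ ?_) fun j _ _ ↦ ?_
        · exact mem_range_succ_iff.2 (mem_Icc.1 hj).2
        · have := hcoeff j
          positivity
    _ = f.eval r / r ^ n := by rw [← sum_div, ← eval_eq_sum_range]

end Sums

section Samples

variable {p : ℕ} {Ω : Type*} [MeasurableSpace Ω] {μ : Measure Ω}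
  {D : (Fin p → Fin 2) → ℝ} {Y : ℕ → Ω → Fin p → Fin 2}

theorem IsIIDSample.measureReal_eq_coeff_genPoly [IsFiniteMeasure μ] (hY : IsIIDSample μ D Y)
    (g : (Fin p → Fin 2) → ℕ) (k j : ℕ) :
    μ.real {ω | g (Y k ω) = j} = (genPoly D g).coeff j := by
  rw [coeff_genPoly, ← sum_congr rfl fun y _ ↦ hY.law k y, ← measureReal_biUnion_finset]
  · congr 1
    ext ω
    simp
  · exact fun x _ y _ hxy ↦ Set.disjoint_left.2 fun ω hx hy ↦ hxy (hx.symm.trans hy)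
  · exact fun y _ ↦ hY.measurable k (measurableSet_singleton y)

theorem IsIIDSample.measureReal_sum_eq_coeff_genPoly_pow [IsProbabilityMeasure μ]
    (hY : IsIIDSample μ D Y) (g : (Fin p → Fin 2) → ℕ) (n j : ℕ) :
    μ.real {ω | ∑ k ∈ range n, g (Y k ω) = j} = (genPoly D g ^ n).coeff j :=
  measureReal_sum_eq_coeff_pow (fun k ↦ (measurable_of_countable g).comp (hY.measurable k))
    (hY.indep.comp (fun _ ↦ g) fun _ ↦ measurable_of_countable g)
    (fun k j ↦ hY.measureReal_eq_coeff_genPoly g k j) n j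

theorem IsIIDSample.measureReal_le_sum_le [IsProbabilityMeasure μ] (hY : IsIIDSample μ D Y)
    (g : (Fin p → Fin 2) → ℕ) {r G : ℝ} (hr : 1 ≤ r) (hG : (genPoly D g).eval r ≤ G * r) (n : ℕ) :
    μ.real {ω | n ≤ ∑ k ∈ range n, g (Y k ω)} ≤ G ^ n := by
  have hr₀ : 0 < r := by linarith
  refine (measureReal_le_eval_div_pow (hY.measureReal_sum_eq_coeff_genPoly_pow g n) hr n).trans ?_
  rw [eval_pow, ← div_pow]
  refine pow_le_pow_left₀ (div_nonneg ?_ hr₀.le) ((div_le_iff₀ hr₀).2 hG) n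
  simp only [genPoly, eval_finsetSum, eval_monomial]
  exact sum_nonneg fun y _ ↦ mul_nonneg (hY.law 0 y ▸ measureReal_nonneg) (by positivity)

end Samples

section Dominant

variable {p : ℕ} {q θ : ℝ} {P : (Fin p → Fin 2) → ℝ} {T : SimpleGraph (Fin p)} {i j k : Fin p}

theorem four_mul_beta₁_add_beta₂ (q θ : ℝ) :
    4 * (beta₁ q θ + beta₂ q θ) = 1 - (1 - 2 * q) ^ 2 * (1 - 2 * θ) := by
  rw [beta₁, beta₂]
  ring

theorem four_mul_beta₁_sub_beta₂ (q θ : ℝ) :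
    4 * (beta₁ q θ - beta₂ q θ) = (1 - 2 * q) ^ 2 * (1 - 2 * θ) * (1 - (1 - 2 * θ)) := by
  rw [beta₁, beta₂]
  ring

theorem beta₂_pos (hq₀ : 0 ≤ q) (hq₁ : q ≤ 1) (hθ₀ : 0 < θ) (hθ₁ : θ ≤ 1) : 0 < beta₂ q θ := by
  have hcubes : 0 < (1 - q) ^ 3 + q ^ 3 := by nlinarith [sq_nonneg (1 - 2 * q)]
  have hsq : 0 ≤ (1 - θ ^ 2) / 2 := by nlinarith
  exact add_pos_of_pos_of_nonneg (mul_pos hcubes (by positivity))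
    (mul_nonneg (mul_nonneg hq₀ (by linarith)) hsq)

theorem beta₂_le_beta₁ (hθ₀ : 0 ≤ θ) (hθ₁ : θ ≤ 1 / 2) : beta₂ q θ ≤ beta₁ q θ := by
  have hdiff : 0 ≤ 4 * (beta₁ q θ - beta₂ q θ) := by
    rw [four_mul_beta₁_sub_beta₂]
    exact mul_nonneg (mul_nonneg (sq_nonneg _) (by linarith)) (by linarith)
  linarith

theorem beta₁_add_beta₂_le (q : ℝ) (hθ : θ ≤ 1 / 2) : beta₁ q θ + beta₂ q θ ≤ 1 / 4 := by
  have hsum := four_mul_beta₁_add_beta₂ q θ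
  have hnonneg : 0 ≤ (1 - 2 * q) ^ 2 * (1 - 2 * θ) := mul_nonneg (sq_nonneg _) (by linarith)
  linarith

theorem IsTreeModel.sum_filter_crossingStep_of_adj_adj (hP : IsTreeModel θ T P) (hij : T.Adj i j)
    (hjk : T.Adj j k) (hik : i ≠ k) (q : ℝ) :
    ∑ y with crossingStep s(i, j) s(i, k) y = 2, bscOutput q P y = 2 * beta₂ q θ ∧
      ∑ y with crossingStep s(i, j) s(i, k) y = 0, bscOutput q P y = 2 * beta₁ q θ := by
  have hw : (Walk.cons hij (.cons hjk .nil)).IsPath := by simp [hij.ne, hjk.ne, hik]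
  have hcard : #(symmDiff s(i, j).toFinset s(i, k).toFinset) = 2 := by
    refine (card_symmDiff_toFinset (by simpa using hij.ne) (by simpa using hik)
      (by simp [hij.ne, hjk.ne'])).resolve_right fun h ↦ ?_
    exact disjoint_left.1 h.2 (show i ∈ s(i, j).toFinset by simp) (by simp)
  have hone := hP.sum_edgeSpin_of_isPath hw
  have hboth := hP.sum_edgeSpin_mul_edgeSpin_of_isPath (e := s(i, j)) hw (by simp)
  simp only [Walk.length_cons, Walk.length_nil, zero_add, Nat.add_one_sub_one, pow_one]
    at hone hboth
  rw [sum_filter_crossingStep_eq_two, sum_filter_crossingStep_eq_zero, hP.sum_bscOutput_eq_one,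
    hP.sum_edgeSpin_mul_bscOutput_of_mem_edgeSet hij,
    sum_edgeSpin_mul_bscOutput q P (by simpa using hik),
    sum_edgeSpin_mul_edgeSpin_mul_bscOutput q P (by simpa using hij.ne) (by simpa using hik),
    hcard, hone, hboth, beta₁, beta₂]
  constructor <;> ring

end Dominant

section Optimization

variable {q θ s ρ κ a b a₀ b₀ t r : ℝ}

theorem one_sub_mul_le_of_le (hs : s ≤ 1) (hκ : κ ≤ ρ) :
    (1 - ρ) * (1 - s * ρ + s * (ρ * κ) - s * κ) ≤ (1 - κ) * (1 - s * ρ - s * ρ * (1 - ρ)) := by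
  have : 0 ≤ (1 - s) * (ρ - κ) := mul_nonneg (by linarith) (by linarith)
  linear_combination this

theorem one_sub_mul_le_of_le_sq (hs₀ : 0 ≤ s) (hs₁ : s ≤ 1) (hρ₀ : 0 ≤ ρ) (hρ₁ : ρ ≤ 1)
    (hκ : κ ≤ ρ ^ 2) :
    (1 - ρ) * (1 - s * ρ + s * (ρ * κ) - s ^ 2 * κ) ≤
      (1 - κ) * (1 - s * ρ - s * ρ * (1 - ρ)) := by
  have hsρ : s * ρ ≤ 1 := mul_le_one₀ hs₁ hρ₀ hρ₁
  have hextremal : 0 ≤ (1 - s) * ((1 - ρ) * ρ * (1 - s * ρ)) :=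
    mul_nonneg (by linarith) (mul_nonneg (mul_nonneg (by linarith) hρ₀) (by linarith))
  have hdecrease : 0 ≤ (1 - s) * ((1 + s - s * ρ) * (ρ ^ 2 - κ)) :=
    mul_nonneg (by linarith) (mul_nonneg (by linarith) (by linarith))
  linear_combination hextremal + hdecrease

variable {p : ℕ} {T : SimpleGraph (Fin p)} {P : (Fin p → Fin 2) → ℝ}

/-- Among all crossings the adjacent edges dominate: here `2β₂` and `2β₁` are their probabilities of
a step up and of a step down. -/
theorem IsTreeModel.exists_one_le_sub_eq_mul (hP : IsTreeModel θ T P) {e f : Sym2 (Fin p)}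
    (hef : IsCrossing T e f) (hq₀ : 0 ≤ q) (hq₁ : q ≤ 1) (hθ₀ : 0 < θ) (hθ₁ : θ ≤ 1 / 2) :
    ∃ t, 1 ≤ t ∧
      ∑ y with crossingStep e f y = 0, bscOutput q P y -
        ∑ y with crossingStep e f y = 2, bscOutput q P y = t * (2 * beta₁ q θ - 2 * beta₂ q θ) ∧
      ∑ y with crossingStep e f y = 2, bscOutput q P y ≤ t * (2 * beta₂ q θ) := by
  obtain ⟨l, hone, hboth⟩ := hP.exists_length_of_isCrossing hef q
  rw [sum_filter_crossingStep_eq_zero, sum_filter_crossingStep_eq_two, hP.sum_bscOutput_eq_one,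
    hP.sum_edgeSpin_mul_bscOutput_of_mem_edgeSet hef.mem_edgeSet, hone]
  have hsum := four_mul_beta₁_add_beta₂ q θ
  have hdiff := four_mul_beta₁_sub_beta₂ q θ
  have hs₀ : 0 ≤ (1 - 2 * q) ^ 2 := sq_nonneg _
  have hs₁ : (1 - 2 * q) ^ 2 ≤ 1 := by nlinarith
  have hs₂ : (1 - 2 * q) ^ 4 = ((1 - 2 * q) ^ 2) ^ 2 := by ring
  have hρ₁ : 0 < 1 - (1 - 2 * θ) := by linarith
  have hρ₀ : 0 ≤ 1 - 2 * θ := by linarith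
  have hpow {m : ℕ} (hm : m ≤ l) : (1 - 2 * θ) ^ l ≤ (1 - 2 * θ) ^ m :=
    pow_le_pow_of_le_one hρ₀ (by linarith) hm
  rw [pow_succ' _ l]
  generalize (1 - 2 * q) ^ 2 = s at *
  generalize 1 - 2 * θ = ρ at *
  have hκ : ρ ^ l ≤ ρ := by
    rcases hboth with ⟨hl, -⟩ | ⟨hl, -⟩ <;> simpa using hpow (m := 1) (by lia)
  generalize ρ ^ l = κ at *
  refine ⟨(1 - κ) / (1 - ρ), (one_le_div hρ₁).2 (by linarith), ?_, ?_⟩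
  · rw [div_mul_eq_mul_div, eq_div_iff hρ₁.ne']
    linear_combination -(1 - κ) / 2 * hdiff
  rw [div_mul_eq_mul_div, le_div_iff₀ hρ₁]
  rcases hboth with ⟨-, h⟩ | ⟨hl, h⟩
  · rw [h]
    linear_combination one_sub_mul_le_of_le hs₁ hκ / 4 + (1 - κ) / 4 * (hdiff - hsum)
  · rw [h, hs₂]
    linear_combination one_sub_mul_le_of_le_sq hs₀ hs₁ hρ₀ (by linarith) (hpow hl) / 4 +
      (1 - κ) / 4 * (hdiff - hsum)

theorem eval_stepPoly_le (hr : 0 ≤ r) (ha₀ : 0 ≤ a₀) (hb₀ : a₀ * r ^ 2 = b₀) (ht : 1 ≤ t)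
    (hdrift : b - a = t * (b₀ - a₀)) (hup : a ≤ t * a₀) :
    (stepPoly a b (1 - a - b)).eval r ≤ (1 - a₀ - b₀ + 2 * (a₀ * r)) * r := by
  have hnonneg : 0 ≤ (r - 1) ^ 2 * ((t * a₀ - a) + a₀ * r * (t - 1)) := by
    have := mul_nonneg (mul_nonneg ha₀ hr) (sub_nonneg.2 ht)
    exact mul_nonneg (sq_nonneg _) (by linarith)
  rw [eval_stepPoly]
  subst hb₀
  linear_combination hnonneg - (r - 1) * hdrift

end Optimization

section Exponent

variable {q θ : ℝ}

/-- The number whose negative logarithm is the error exponent: the error probability decays like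
its `n`-th power. -/
noncomputable def decayBase (q θ : ℝ) : ℝ :=
  1 - 4 * ((beta₁ q θ + beta₂ q θ) / 2 - √(beta₁ q θ * beta₂ q θ))

/-- The optimal parameter in Chernoff's bound for a crossing of two adjacent edges. -/
noncomputable def tilt (q θ : ℝ) : ℝ := √(beta₁ q θ / beta₂ q θ)

theorem one_le_tilt (hβ₂ : 0 < beta₂ q θ) (hβ : beta₂ q θ ≤ beta₁ q θ) : 1 ≤ tilt q θ :=
  Real.one_le_sqrt.2 ((one_le_div hβ₂).2 hβ)

theorem beta₂_mul_tilt_sq (hβ₂ : 0 < beta₂ q θ) (hβ : beta₂ q θ ≤ beta₁ q θ) :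
    beta₂ q θ * tilt q θ ^ 2 = beta₁ q θ := by
  rw [tilt, Real.sq_sqrt (div_nonneg (hβ₂.le.trans hβ) hβ₂.le), mul_div_cancel₀ _ hβ₂.ne']

theorem decayBase_eq (hβ₂ : 0 < beta₂ q θ) (hβ : beta₂ q θ ≤ beta₁ q θ) :
    decayBase q θ = 1 - 2 * beta₂ q θ - 2 * beta₁ q θ + 2 * (2 * beta₂ q θ * tilt q θ) := by
  have hsqrt : √(beta₁ q θ * beta₂ q θ) = beta₂ q θ * tilt q θ := by
    rw [← beta₂_mul_tilt_sq hβ₂ hβ, Real.sqrt_eq_iff_mul_self_eq_of_pos]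
    · ring
    · exact mul_pos hβ₂ (zero_lt_one.trans_le (one_le_tilt hβ₂ hβ))
  rw [decayBase, hsqrt]
  ring

theorem decayBase_le_one (hβ₂ : 0 ≤ beta₂ q θ) (hβ₁ : 0 ≤ beta₁ q θ) : decayBase q θ ≤ 1 := by
  have hamgm : √(beta₁ q θ * beta₂ q θ) ≤ (beta₁ q θ + beta₂ q θ) / 2 :=
    Real.sqrt_le_iff.2 ⟨by linarith, by nlinarith [sq_nonneg (beta₁ q θ - beta₂ q θ)]⟩
  rw [decayBase]
  linarith

theorem decayBase_pos (q : ℝ) (hθ : θ ≤ 1 / 2) : 0 < decayBase q θ := by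
  have := beta₁_add_beta₂_le q hθ
  have := Real.sqrt_nonneg (beta₁ q θ * beta₂ q θ)
  rw [decayBase]
  linarith

theorem noisyExponent_zero (hθ : 0 ≤ θ) :
    noisyExponent 0 θ = -Real.log (1 - θ * (1 - √(4 * θ * (1 - θ)))) := by
  have hβ₁ : beta₁ 0 θ = θ * (1 - θ) / 2 := by rw [beta₁]; ring
  have hβ₂ : beta₂ 0 θ = θ ^ 2 / 2 := by rw [beta₂]; ring
  have hsqrt : √(beta₁ 0 θ * beta₂ 0 θ) = θ / 4 * √(4 * θ * (1 - θ)) := by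
    rw [hβ₁, hβ₂, ← Real.sqrt_sq (by positivity : 0 ≤ θ / 4), ← Real.sqrt_mul (by positivity)]
    ring_nf
  rw [noisyExponent, hsqrt, hβ₁, hβ₂]
  ring_nf

theorem tendsto_neg_inv_mul_log {u : ℕ → ℝ} {G K c : ℝ} (hG : 0 < G) (hc : 0 < c)
    (hlower : ∀ n ≠ 0, c * (G ^ n / (n + 1)) ≤ u n) (hupper : ∀ n ≠ 0, u n ≤ K * G ^ n) :
    Tendsto (fun n : ℕ ↦ -(1 / (n : ℝ)) * Real.log (u n)) atTop (𝓝 (-Real.log G)) := by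
  have hpos : ∀ n ≠ 0, 0 < u n := fun n hn ↦ lt_of_lt_of_le (by positivity) (hlower n hn)
  have hK : 0 < K := pos_of_mul_pos_left ((hpos 1 one_ne_zero).trans_le (hupper 1 one_ne_zero))
    (by positivity)
  have hconst (x : ℝ) : Tendsto (fun n : ℕ ↦ x / (n : ℝ)) atTop (𝓝 0) :=
    tendsto_const_div_atTop_nhds_zero_nat x
  have hlog : Tendsto (fun n : ℕ ↦ Real.log (n + 1) / (n : ℝ)) atTop (𝓝 0) := by
    simpa [Function.comp_def] using
      (Real.tendsto_pow_log_div_mul_add_atTop 1 (-1) 1 one_ne_zero).comp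
        (tendsto_natCast_atTop_atTop.atTop_add (tendsto_const_nhds (x := (1 : ℝ))))
  refine tendsto_of_tendsto_of_tendsto_of_le_of_le'
    (g := fun n : ℕ ↦ -Real.log G - Real.log K / n)
    (h := fun n : ℕ ↦ -Real.log G - Real.log c / n + Real.log (n + 1) / n) ?_ ?_ ?_ ?_
  · simpa using (hconst (Real.log K)).const_sub (-Real.log G)
  · simpa using ((hconst (Real.log c)).const_sub (-Real.log G)).add hlog
  all_goals
    filter_upwards [eventually_gt_atTop 0] with n hn
    have hn₀ : (0 : ℝ) < n := Nat.cast_pos.2 hn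
  · have hle := Real.log_le_log (hpos n hn.ne') (hupper n hn.ne')
    rw [Real.log_mul hK.ne' (by positivity), Real.log_pow] at hle
    field_simp
    linarith
  · have hle := Real.log_le_log (by positivity) (hlower n hn.ne')
    rw [Real.log_mul hc.ne' (by positivity), Real.log_div (by positivity) (by positivity),
      Real.log_pow] at hle
    field_simp
    linarith

end Exponent

section Weights

variable {p n : ℕ}

theorem pairMarginal_empiricalDist (y : Fin n → Fin p → Fin 2) (i j : Fin p) (a b : Fin 2) :
    pairMarginal (empiricalDist y) i j a b =
      1 / (n : ℝ) * ∑ m, if y m i = a ∧ y m j = b then 1 else 0 := by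
  simp only [pairMarginal, empiricalDist]
  rw [← mul_sum, sum_comm]
  simp [sum_ite_eq]

theorem agreementWeight_eq (y : Fin n → Fin p → Fin 2) (e : Sym2 (Fin p)) :
    agreementWeight y e = 1 / (n : ℝ) * ∑ m, if (e.map (y m)).IsDiag then 1 else 0 := by
  induction e with
  | h i j =>
    change pairMarginal (empiricalDist y) i j 0 0 + pairMarginal (empiricalDist y) i j 1 1 = _
    rw [pairMarginal_empiricalDist, pairMarginal_empiricalDist, ← mul_add, ← sum_add_distrib]
    congr! 2 with m
    generalize y m = x
    simp only [Sym2.map_mk, Sym2.mk_isDiag_iff]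
    generalize x i = c, x j = d
    revert c d
    simp [Fin.forall_fin_two]

theorem agreementWeight_sub_agreementWeight (y : ℕ → Fin p → Fin 2) (e f : Sym2 (Fin p)) :
    agreementWeight (fun m : Fin n ↦ y m) f - agreementWeight (fun m : Fin n ↦ y m) e =
      1 / (n : ℝ) * ((∑ m ∈ range n, crossingStep e f (y m) : ℕ) - n) := by
  rw [agreementWeight_eq, agreementWeight_eq, ← mul_sub, ← sum_sub_distrib,
    ← Fin.sum_univ_eq_sum_range fun m ↦ crossingStep e f (y m)]
  have hstep (m : Fin n) : (if (f.map (y m)).IsDiag then 1 else 0) -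
      (if (e.map (y m)).IsDiag then 1 else 0) = (crossingStep e f (y m) : ℝ) - 1 := by
    linear_combination -crossingStep_add_ite_isDiag (e := e) (f := f) (y m)
  simp [hstep]

theorem agreementWeight_le_iff (hn : n ≠ 0) (y : ℕ → Fin p → Fin 2) (e f : Sym2 (Fin p)) :
    agreementWeight (fun m : Fin n ↦ y m) e ≤ agreementWeight (fun m : Fin n ↦ y m) f ↔
      n ≤ ∑ m ∈ range n, crossingStep e f (y m) := by
  have hn' : (0 : ℝ) < 1 / n := by positivity
  rw [← sub_nonneg, agreementWeight_sub_agreementWeight, mul_nonneg_iff_of_pos_left hn',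
    sub_nonneg, Nat.cast_le]

theorem agreementWeight_lt_iff (hn : n ≠ 0) (y : ℕ → Fin p → Fin 2) (e f : Sym2 (Fin p)) :
    agreementWeight (fun m : Fin n ↦ y m) e < agreementWeight (fun m : Fin n ↦ y m) f ↔
      n < ∑ m ∈ range n, crossingStep e f (y m) := by
  have hn' : (0 : ℝ) < 1 / n := by positivity
  rw [← sub_pos, agreementWeight_sub_agreementWeight, mul_pos_iff_of_pos_left hn', sub_pos,
    Nat.cast_lt]

end Weights

section ErrorProbability

variable {p : ℕ} {q θ : ℝ} {T : SimpleGraph (Fin p)} {P : (Fin p → Fin 2) → ℝ}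

theorem IsTreeModel.eval_genPoly_crossingStep_le (hP : IsTreeModel θ T P) {e f : Sym2 (Fin p)}
    (hef : IsCrossing T e f) (hq₀ : 0 ≤ q) (hq₁ : q ≤ 1) (hθ₀ : 0 < θ) (hθ₁ : θ ≤ 1 / 2) :
    (genPoly (bscOutput q P) (crossingStep e f)).eval (tilt q θ) ≤
      decayBase q θ * tilt q θ := by
  obtain ⟨t, ht, hdrift, hup⟩ := hP.exists_one_le_sub_eq_mul hef hq₀ hq₁ hθ₀ hθ₁
  have hβ₂ := beta₂_pos hq₀ hq₁ hθ₀ (by linarith)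
  have hβ := beta₂_le_beta₁ (q := q) hθ₀.le hθ₁
  have htilt : 2 * beta₂ q θ * tilt q θ ^ 2 = 2 * beta₁ q θ := by
    rw [mul_assoc, beta₂_mul_tilt_sq hβ₂ hβ]
  rw [genPoly_eq_stepPoly _ (crossingStep_le_two e f), hP.sum_bscOutput_eq_one,
    decayBase_eq hβ₂ hβ]
  exact eval_stepPoly_le (Real.sqrt_nonneg _) (by positivity) htilt ht hdrift hup

theorem IsTreeModel.genPoly_crossingStep_of_adj_adj (hP : IsTreeModel θ T P) {i j k : Fin p}
    (hij : T.Adj i j) (hjk : T.Adj j k) (hik : i ≠ k) (q : ℝ) :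
    genPoly (bscOutput q P) (crossingStep s(i, j) s(i, k)) =
      stepPoly (2 * beta₂ q θ) (2 * beta₁ q θ) (1 - 2 * beta₂ q θ - 2 * beta₁ q θ) := by
  obtain ⟨htwo, hzero⟩ := hP.sum_filter_crossingStep_of_adj_adj hij hjk hik q
  rw [genPoly_eq_stepPoly _ (crossingStep_le_two _ _), htwo, hzero, hP.sum_bscOutput_eq_one]

variable {Ω : Type*} [MeasurableSpace Ω] {μ : Measure Ω} [IsProbabilityMeasure μ]
  {Y : ℕ → Ω → Fin p → Fin 2} {n : ℕ} {E : Ω → SimpleGraph (Fin p)}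

open Classical in
theorem IsTreeModel.measureReal_ne_le (hP : IsTreeModel θ T P)
    (hY : IsIIDSample μ (bscOutput q P) Y) (hq₀ : 0 ≤ q) (hq₁ : q ≤ 1) (hθ₀ : 0 < θ)
    (hθ₁ : θ ≤ 1 / 2) (hn : n ≠ 0)
    (hE : ∀ᵐ ω ∂μ, IsMWST (agreementWeight fun k : Fin n ↦ Y k ω) (E ω)) :
    μ.real {ω | E ω ≠ T} ≤
      #{x : Sym2 (Fin p) × Sym2 (Fin p) | IsCrossing T x.1 x.2} * decayBase q θ ^ n := by
  have hcover : {ω | E ω ≠ T} ≤ᵐ[μ]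
      ⋃ x ∈ ({x | IsCrossing T x.1 x.2} : Finset (Sym2 (Fin p) × Sym2 (Fin p))),
        {ω | n ≤ ∑ k ∈ range n, crossingStep x.1 x.2 (Y k ω)} := by
    filter_upwards [hE] with ω hω hne
    obtain ⟨e, f, hef, hle⟩ := hω.exists_isCrossing hP.isTree hne
    exact Set.mem_biUnion (x := (e, f)) (by simpa using hef)
      ((agreementWeight_le_iff hn (fun k ↦ Y k ω) e f).1 hle)
  have htilt := one_le_tilt (beta₂_pos hq₀ hq₁ hθ₀ (by linarith)) (beta₂_le_beta₁ hθ₀.le hθ₁)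
  refine (ENNReal.toReal_mono (measure_ne_top _ _) (measure_mono_ae hcover)).trans
    ((measureReal_biUnion_finset_le _ _).trans ?_)
  rw [← nsmul_eq_mul]
  refine sum_le_card_nsmul _ _ _ fun x hx ↦ hY.measureReal_le_sum_le _ htilt ?_ n
  exact hP.eval_genPoly_crossingStep_le (mem_filter.1 hx).2 hq₀ hq₁ hθ₀ hθ₁

theorem IsTreeModel.le_measureReal_ne (hp : 2 < p) (hP : IsTreeModel θ T P)
    (hY : IsIIDSample μ (bscOutput q P) Y) (hq₀ : 0 ≤ q) (hq₁ : q ≤ 1) (hθ₀ : 0 < θ)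
    (hθ₁ : θ ≤ 1 / 2) (hn : n ≠ 0)
    (hE : ∀ᵐ ω ∂μ, IsMWST (agreementWeight fun k : Fin n ↦ Y k ω) (E ω)) :
    (2 * beta₂ q θ) ^ 2 * (decayBase q θ ^ n / (n + 1)) ≤ μ.real {ω | E ω ≠ T} := by
  obtain ⟨i, j, k, hij, hjk, hik⟩ := exists_adj_adj_ne hP.isTree.connected (by simpa using hp)
  have hsub : {ω | n < ∑ m ∈ range n, crossingStep s(i, j) s(i, k) (Y m ω)} ≤ᵐ[μ]
      {ω | E ω ≠ T} := by
    filter_upwards [hE] with ω hω hlt hET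
    rw [hET] at hω
    have hpath : (Walk.cons hij (.cons hjk .nil)).IsPath := by simp [hij.ne, hjk.ne, hik]
    exact ((agreementWeight_lt_iff hn (fun m ↦ Y m ω) _ _).2 hlt).not_ge
      (hω.weight_le hpath (by simp))
  have hβ₂ := beta₂_pos hq₀ hq₁ hθ₀ (by linarith)
  have hβ := beta₂_le_beta₁ (q := q) hθ₀.le hθ₁
  have hsum := beta₁_add_beta₂_le q hθ₁
  have hG := decayBase_le_one hβ₂.le (hβ₂.le.trans hβ)
  rw [decayBase_eq hβ₂ hβ] at hG ⊢
  obtain ⟨l, hl, hle⟩ := exists_lt_le_coeff_stepPoly_pow (n := n) (b := 2 * beta₁ q θ)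
    (r := tilt q θ) (by positivity) (by linarith) (by linarith) (by linarith)
    (zero_lt_one.trans_le (one_le_tilt hβ₂ hβ))
    (by rw [mul_assoc, beta₂_mul_tilt_sq hβ₂ hβ]) hG hn
  rw [← hP.genPoly_crossingStep_of_adj_adj hij hjk hik,
    ← hY.measureReal_sum_eq_coeff_genPoly_pow] at hle
  refine hle.trans (ENNReal.toReal_mono (measure_ne_top _ _) ((measure_mono fun ω hω ↦ ?_).trans
    (measure_mono_ae hsub)))
  exact hl.trans_eq hω.symm

theorem IsTreeModel.hasErrorExponent_of_isMWST (hp : 2 < p) (hP : IsTreeModel θ T P)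
    (hY : IsIIDSample μ (bscOutput q P) Y) (hq₀ : 0 ≤ q) (hq₁ : q ≤ 1) (hθ₀ : 0 < θ)
    (hθ₁ : θ ≤ 1 / 2) {E : ℕ → Ω → SimpleGraph (Fin p)}
    (hE : ∀ n, ∀ᵐ ω ∂μ, IsMWST (agreementWeight fun k : Fin n ↦ Y k ω) (E n ω)) :
    HasErrorExponent μ T E (noisyExponent q θ) := by
  have hβ₂ := beta₂_pos hq₀ hq₁ hθ₀ (by linarith)
  exact tendsto_neg_inv_mul_log (decayBase_pos q hθ₁) (c := (2 * beta₂ q θ) ^ 2)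
    (by positivity) (fun n hn ↦ hP.le_measureReal_ne hp hY hq₀ hq₁ hθ₀ hθ₁ hn (hE n))
    fun n hn ↦ hP.measureReal_ne_le hY hq₀ hq₁ hθ₀ hθ₁ hn (hE n)

end ErrorProbability

section MaximumLikelihood

variable {V : Type*} {p n : ℕ} {θ : ℝ} {G : SimpleGraph (Fin p)}

theorem one_add_mul_edgeSpin_pos (hθ₀ : 0 < θ) (hθ₁ : θ < 1) (x : V → Fin 2) (e : Sym2 V) :
    0 < 1 + (1 - 2 * θ) * edgeSpin x e := by
  rcases (abs_eq zero_le_one).1 (abs_edgeSpin x e) with h | h <;> rw [h] <;> linarith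

theorem log_isingWeight [Fintype V] (hθ₀ : 0 < θ) (hθ₁ : θ < 1) (F : Finset (Sym2 V))
    (x : V → Fin 2) :
    Real.log (isingWeight (1 - 2 * θ) F x) = Fintype.card V * Real.log (1 / 2) +
      ∑ e ∈ F, Real.log (1 + (1 - 2 * θ) * edgeSpin x e) := by
  have hne (e) : 1 + (1 - 2 * θ) * edgeSpin x e ≠ 0 := (one_add_mul_edgeSpin_pos hθ₀ hθ₁ x e).ne'
  rw [isingWeight, Real.log_mul (by positivity) (prod_ne_zero_iff.2 fun e _ ↦ hne e),
    Real.log_pow, Real.log_prod fun e _ ↦ hne e]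

theorem sum_log_one_add_mul_edgeSpin (hn : n ≠ 0) (θ : ℝ) (x : Fin n → Fin p → Fin 2)
    (e : Sym2 (Fin p)) :
    ∑ m, Real.log (1 + (1 - 2 * θ) * edgeSpin (x m) e) = n * (Real.log (2 * θ) +
      (Real.log (2 * (1 - θ)) - Real.log (2 * θ)) * agreementWeight x e) := by
  have hlog (m : Fin n) : Real.log (1 + (1 - 2 * θ) * edgeSpin (x m) e) = Real.log (2 * θ) +
      (Real.log (2 * (1 - θ)) - Real.log (2 * θ)) *
        if (e.map (x m)).IsDiag then 1 else 0 := by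
    have hspin := ite_isDiag_map (x m) e
    split_ifs at hspin ⊢
    · rw [show edgeSpin (x m) e = 1 by linarith, mul_one, mul_one, add_sub_cancel]
      ring_nf
    · rw [show edgeSpin (x m) e = -1 by linarith, mul_zero, add_zero]
      ring_nf
  simp only [hlog, sum_add_distrib, ← mul_sum, agreementWeight_eq, sum_const, card_univ,
    Fintype.card_fin, nsmul_eq_mul]
  field_simp

theorem IsTreeModel.sum_log {Q : (Fin p → Fin 2) → ℝ} (hQ : IsTreeModel θ G Q) (hθ₀ : 0 < θ)
    (hθ₁ : θ < 1) (hn : n ≠ 0) (x : Fin n → Fin p → Fin 2) :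
    ∑ m, Real.log (Q (x m)) = n * (p * Real.log (1 / 2) + (p - 1) * Real.log (2 * θ) +
      (Real.log (2 * (1 - θ)) - Real.log (2 * θ)) * graphWeight (agreementWeight x) G) := by
  classical
  have hcard : (#G.edgeFinset : ℝ) = p - 1 := by
    rw [eq_sub_iff_add_eq]
    exact_mod_cast hQ.isTree.card_edgeFinset.trans (Fintype.card_fin p)
  simp only [hQ.eq_isingWeight, log_isingWeight hθ₀ hθ₁]
  rw [sum_add_distrib, sum_comm]
  simp only [sum_log_one_add_mul_edgeSpin hn, ← mul_sum, sum_add_distrib, sum_const, card_univ,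
    Fintype.card_fin, nsmul_eq_mul, hcard, graphWeight]
  ring

theorem IsMLTree.isMWST (hθ₀ : 0 < θ) (hθ₁ : θ < 1 / 2) {x : Fin n → Fin p → Fin 2}
    (h : IsMLTree θ x G) : IsMWST (agreementWeight x) G := by
  classical
  obtain ⟨Q, hQ, hmax⟩ := h
  refine ⟨hQ.isTree, fun G' hG' ↦ ?_⟩
  rcases eq_or_ne n 0 with rfl | hn
  · simp [graphWeight, agreementWeight_eq]
  have hG'model := isTreeModel_isingWeight hG' hθ₀.le (by linarith)
  have hle := hmax G' _ hG'model
  have hn' : (0 : ℝ) < n := by positivity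
  rw [hQ.sum_log hθ₀ (by linarith) hn, hG'model.sum_log hθ₀ (by linarith) hn,
    mul_le_mul_iff_right₀ hn', add_le_add_iff_left] at hle
  exact le_of_mul_le_mul_left hle
    (sub_pos.2 (Real.log_lt_log (by linarith) (by linarith)))

end MaximumLikelihood

theorem mainTheorem4_general {p : ℕ} (hp : 2 < p) {θ : ℝ} (hθ₀ : 0 < θ) (hθ₁ : θ ≤ 1 / 2)
    {T : SimpleGraph (Fin p)} {P : (Fin p → Fin 2) → ℝ} (hP : IsTreeModel θ T P)
    {Ω : Type*} [MeasurableSpace Ω] (μ : Measure Ω) [IsProbabilityMeasure μ] :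
    (∀ q : ℝ, 0 ≤ q → q ≤ 1 → ∀ Y : ℕ → Ω → Fin p → Fin 2,
      IsIIDSample μ (bscOutput q P) Y →
      ∀ E : ℕ → Ω → SimpleGraph (Fin p),
        (∀ n, ∀ᵐ ω ∂μ, IsMWST (agreementWeight fun k : Fin n ↦ Y k ω) (E n ω)) →
        HasErrorExponent μ T E (noisyExponent q θ)) ∧
    (θ < 1 / 2 → ∀ X : ℕ → Ω → Fin p → Fin 2,
      IsIIDSample μ P X →
      ∀ E : ℕ → Ω → SimpleGraph (Fin p),
        (∀ n, ∀ᵐ ω ∂μ, IsMLTree θ (fun k : Fin n ↦ X k ω) (E n ω)) →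
        HasErrorExponent μ T E (noisyExponent 0 θ)) ∧
    noisyExponent 0 θ = -Real.log (1 - θ * (1 - √(4 * θ * (1 - θ)))) := by
  refine ⟨fun q hq₀ hq₁ Y hY E hE ↦ hP.hasErrorExponent_of_isMWST hp hY hq₀ hq₁ hθ₀ hθ₁ hE,
    fun hθ X hX E hE ↦ ?_, noisyExponent_zero hθ₀.le⟩
  rw [← bscOutput_zero P] at hX
  refine hP.hasErrorExponent_of_isMWST hp hX le_rfl zero_le_one hθ₀ hθ₁ fun n ↦ ?_
  filter_upwards [hE n] with ω hω using hω.isMWST hθ₀ hθ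

theorem mainTheorem4 {p : ℕ} (hp : 2 < p) {θ : ℝ} (hθ₀ : 0 < θ) (hθ₁ : θ < 1 / 2)
    {T : SimpleGraph (Fin p)} {P : (Fin p → Fin 2) → ℝ} (hP : IsTreeModel θ T P)
    {Ω : Type*} [MeasurableSpace Ω] (μ : Measure Ω) [IsProbabilityMeasure μ] :
    (∀ q : ℝ, 0 ≤ q → q < 1 / 2 → ∀ Y : ℕ → Ω → Fin p → Fin 2,
      IsIIDSample μ (bscOutput q P) Y →
      ∀ E : ℕ → Ω → SimpleGraph (Fin p),
        (∀ n G, MeasurableSet {ω | E n ω = G}) →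
        (∀ n, ∀ᵐ ω ∂μ, IsMWST (agreementWeight fun k : Fin n => Y k ω) (E n ω)) →
        HasErrorExponent μ T E (noisyExponent q θ)) ∧
    (∀ X : ℕ → Ω → Fin p → Fin 2,
      IsIIDSample μ P X →
      ∀ E : ℕ → Ω → SimpleGraph (Fin p),
        (∀ n G, MeasurableSet {ω | E n ω = G}) →
        (∀ n, ∀ᵐ ω ∂μ, IsMLTree θ (fun k : Fin n => X k ω) (E n ω)) →
        HasErrorExponent μ T E (noisyExponent 0 θ)) ∧
    noisyExponent 0 θ = -Real.log (1 - θ * (1 - √(4 * θ * (1 - θ)))) := by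
  obtain ⟨hnoisy, hML, hvalue⟩ := mainTheorem4_general hp hθ₀ hθ₁.le hP μ
  exact ⟨fun q hq₀ hq₁ Y hY E _ ↦ hnoisy q hq₀ (by linarith) Y hY E,
    fun X hX E _ ↦ hML hθ₁ X hX E, hvalue⟩
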